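/- Let $\mathrm{Mp}$ be the metaplectic cover of $\mathrm{SL}_2(\mathbb R)$: the group of pairs $\sigma=(g_\sigma,\eta_\sigma)$, where $g_\sigma=\begin{pmatrix}a_\sigma&b_\sigma\\c_\sigma&d_\sigma\end{pmatrix}\in\mathrm{SL}_2(\mathbb R)$ and $\eta_\sigma$ is a holomorphic function on the upper half-plane $\mathcal H$ with $\eta_\sigma(z)^2=c_\sigma z+d_\sigma$, with multiplication $\sigma_1\sigma_2=(g_{\sigma_1}g_{\sigma_2},\ \eta_{\sigma_1}(g_{\sigma_2}.z)\,\eta_{\sigma_2}(z))$ and its usual Lie group topology. Let $Z(\mathrm{Mp})$ be its center, let $P(\sigma)=g_\sigma$, and for $x\in\mathbb R$ let $n_x=\left(\begin{pmatrix}1&x\\0&1\end{pmatrix},1\right)$. Let $m\in\frac52+\mathbb Z_{\ge0}$. Let $\Gamma$ be a discrete subgroup of finite covolume in $\mathrm{Mp}$ such that $\infty$ is a cusp of $P(\Gamma)$, and let $\Gamma_\infty=\{\gamma\in\Gamma:\gamma.\infty=\infty\}$. Let $\chi:\Gamma\to\mathbb C^\times$ be a character of finite order such that $\eta_\gamma^{-2m}=\chi(\gamma)$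 for all $\gamma\in\Gamma_\infty$. Let $h>0$ be such that $Z(\mathrm{Mp})\Gamma_\infty=Z(\mathrm{Mp})\langle n_h\rangle$, and put $$N=\inf\left\{|c|:\begin{pmatrix}a&b\\c&d\end{pmatrix}\in P(\Gamma\setminus\Gamma_\infty)\right\}.$$ For $f:\mathcal H\to\mathbb C$ and $\sigma\in\mathrm{Mp}$ write $(f|_m\sigma)(z)=f(g_\sigma.z)\,\eta_\sigma(z)^{-2m}$. For $s\in\mathbb C$ let $$F(z,s)=\sum_{n=1}^\infty n^{s-1}e^{2\pi i n z/h},\qquad \Psi_{\Gamma,m,\chi,s}(z)=\sum_{\gamma\in\Gamma_\infty\backslash\Gamma}\overline{\chi(\gamma)}\,\bigl(F(\cdot,s)|_m\gamma\bigr)(z),\qquad z\in\mathcal H.$$ Suppose that $m\ge\frac{4\pi}{Nh}+\frac83$, and let $1<\operatorname{Re}(s)<\frac m2$. If $$e^{\frac\pi2|\operatorname{Im}(s)|}\,\Gamma\!\left(\tfrac{\operatorname{Re}(s)+1}2\right)\Gamma\!\left(\tfrac{\operatorname{Re}(s)-1}2\right)\frac{2^{\frac m2-1}}{\Gamma\!\left(\frac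 m2-1\right)}\cdot\frac{\left(\frac{\pi}{Nh}\right)^{\frac m2-\operatorname{Re}(s)}}{\frac m2-\operatorname{Re}(s)}\le\pi$$ (where $\Gamma(\cdot)$ is the gamma function), then $\Psi_{\Gamma,m,\chi,s}$ is not identically zero on $\mathcal H$. -/

import Mathlib

open UpperHalfPlane MeasureTheory
open scoped MatrixGroups Manifold Topology

/-- The metaplectic cover of `SL(2, ℝ)`: pairs `(g, η)` of a matrix `g = (a, b; c, d)` and a
holomorphic function `η` on the upper half-plane with `η(z)² = c z + d`. -/
@[ext]
structure Mp2 where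
  /-- the matrix `g` -/
  mat : SL(2, ℝ)
  /-- the holomorphic square root `η` -/
  eta : ℍ → ℂ
  holo : MDifferentiable 𝓘(ℂ) 𝓘(ℂ) eta
  eta_sq : ∀ z : ℍ, eta z ^ 2 = (mat 1 0 : ℂ) * (z : ℂ) + (mat 1 1 : ℂ)

namespace Mp2

theorem denom_ne (g : SL(2, ℝ)) (z : ℍ) : (g 1 0 : ℂ) * (z : ℂ) + (g 1 1 : ℂ) ≠ 0 :=
  UpperHalfPlane.denom_ne_zero (g : GL (Fin 2) ℝ) z

theorem denom_mul (g h : SL(2, ℝ)) (z : ℍ) :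
    ((g * h) 1 0 : ℂ) * (z : ℂ) + ((g * h) 1 1 : ℂ) =
      ((g 1 0 : ℂ) * ((h • z : ℍ) : ℂ) + (g 1 1 : ℂ)) *
        ((h 1 0 : ℂ) * (z : ℂ) + (h 1 1 : ℂ)) := by
  have hz := denom_ne h z
  rw [coe_specialLinearGroup_apply]
  simp only [Algebra.algebraMap_self, RingHom.id_apply, Matrix.SpecialLinearGroup.coe_mul,
    Matrix.mul_apply, Fin.sum_univ_two]
  rw [add_mul, mul_assoc, div_mul_cancel₀ _ hz]
  push_cast
  ring

theorem mdiff_smul (g : SL(2, ℝ)) :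
    MDifferentiable 𝓘(ℂ) 𝓘(ℂ) (fun z : ℍ => g • z) :=
  UpperHalfPlane.mdifferentiable_smul (g := Matrix.SpecialLinearGroup.mapGL ℝ g) (by simp)

theorem eta_ne (σ : Mp2) (z : ℍ) : σ.eta z ≠ 0 := by
  intro h
  have := σ.eta_sq z
  rw [h] at this
  exact denom_ne σ.mat z (by rw [← this]; simp)

noncomputable instance : Mul Mp2 where
  mul σ τ :=
    { mat := σ.mat * τ.mat
      eta := fun z => σ.eta (τ.mat • z) * τ.eta z
      holo := (σ.holo.comp (mdiff_smul τ.mat)).mul τ.holo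
      eta_sq := fun z => by rw [mul_pow, σ.eta_sq, τ.eta_sq, denom_mul] }

noncomputable instance : One Mp2 where
  one :=
    { mat := 1
      eta := fun _ => 1
      holo := mdifferentiable_const
      eta_sq := fun z => by simp }

noncomputable instance : Inv Mp2 where
  inv σ :=
    { mat := σ.mat⁻¹
      eta := fun z => (σ.eta (σ.mat⁻¹ • z))⁻¹
      holo := by
        have h := σ.holo.comp (mdiff_smul σ.mat⁻¹)
        rw [UpperHalfPlane.mdifferentiable_iff] at h ⊢
        exact h.inv (fun z _ => σ.eta_ne _)
      eta_sq := fun z => by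
        have h := denom_mul σ.mat σ.mat⁻¹ z
        rw [inv_pow, σ.eta_sq]
        refine inv_eq_of_mul_eq_one_right ?_
        rw [← h]
        simp }

@[simp] theorem mul_mat (σ τ : Mp2) : (σ * τ).mat = σ.mat * τ.mat := rfl
@[simp] theorem mul_eta (σ τ : Mp2) (z : ℍ) :
    (σ * τ).eta z = σ.eta (τ.mat • z) * τ.eta z := rfl
@[simp] theorem one_mat : (1 : Mp2).mat = 1 := rfl
@[simp] theorem one_eta (z : ℍ) : (1 : Mp2).eta z = 1 := rfl
@[simp] theorem inv_mat (σ : Mp2) : (σ⁻¹).mat = σ.mat⁻¹ := rfl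
@[simp] theorem inv_eta (σ : Mp2) (z : ℍ) :
    (σ⁻¹).eta z = (σ.eta (σ.mat⁻¹ • z))⁻¹ := rfl

noncomputable instance : Group Mp2 :=
  Group.ofLeftAxioms
    (fun a b c => by
      ext z
      · simp [mul_assoc]
      · simp [mul_smul, mul_assoc])
    (fun a => by ext z <;> simp)
    (fun a => by
      ext z
      · simp
      · simp [eta_ne])

/-- The covering projection `P : Mp2 → SL(2, ℝ)`, `(g, η) ↦ g`. -/
noncomputable def proj : Mp2 →* SL(2, ℝ) where
  toFun := mat
  map_one' := rfl
  map_mul' _ _ := rfl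

/-- The element `n_x = ((1, x; 0, 1), 1)`. -/
noncomputable def n (x : ℝ) : Mp2 where
  mat := ⟨!![1, x; 0, 1], by simp⟩
  eta := fun _ => 1
  holo := mdifferentiable_const
  eta_sq := fun z => by simp

/-! ### Topology and Haar measure

An element `(g, η)` is determined by `(g, η(i))`, and `Mp2` carries the topology of the closed
subset `{(g, w) | w² = c i + d}` of `SL(2, ℝ) × ℂ`. -/

noncomputable instance : TopologicalSpace Mp2 :=
  TopologicalSpace.induced (fun σ => (σ.mat, σ.eta I)) inferInstance

/-- The normalized factor `(c z + d) / (c i + d)`. -/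
noncomputable def ratio (g : SL(2, ℝ)) (z : ℍ) : ℂ :=
  ((g 1 0 : ℂ) * (z : ℂ) + (g 1 1 : ℂ)) / ((g 1 0 : ℂ) * ((I : ℍ) : ℂ) + (g 1 1 : ℂ))

theorem ratio_mem (g : SL(2, ℝ)) (z : ℍ) : ratio g z ∈ Complex.slitPlane := by
  by_contra hcon
  rw [Complex.mem_slitPlane_iff, not_or, not_lt, not_not] at hcon
  obtain ⟨hre, him⟩ := hcon
  have hI := denom_ne g I
  have hz := denom_ne g z
  have hE : (g 1 0 : ℂ) * (z : ℂ) + (g 1 1 : ℂ) =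
      ((ratio g z).re : ℂ) * ((g 1 0 : ℂ) * ((I : ℍ) : ℂ) + (g 1 1 : ℂ)) := by
    have : ((ratio g z).re : ℂ) = ratio g z := Complex.ext (by simp) (by simp [him])
    rw [this, ratio, div_mul_cancel₀ _ hI]
  set r := (ratio g z).re
  have h1 := congrArg Complex.im hE
  have h2 := congrArg Complex.re hE
  simp at h1 h2
  have hc : g 1 0 = 0 := by
    have h3 : g 1 0 * (z.im - r) = 0 := by linarith
    rcases mul_eq_zero.mp h3 with h | h
    · exact h
    · have := z.im_pos
      linarith
  rw [hc] at h2 hz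
  have hd : g 1 1 * (1 - r) = 0 := by linarith
  rcases mul_eq_zero.mp hd with h | h
  · exact hz (by simp [h])
  · linarith

theorem continuous_ratio : Continuous (fun p : SL(2, ℝ) × ℍ => ratio p.1 p.2) := by
  unfold ratio
  refine Continuous.div (by fun_prop) (by fun_prop) (fun p => denom_ne p.1 I)

theorem eta_eq (σ : Mp2) (z : ℍ) :
    σ.eta z = σ.eta I * ratio σ.mat z ^ (1 / 2 : ℂ) := by
  have hsq : ∀ w : ℂ, (w ^ (1 / 2 : ℂ)) ^ 2 = w := fun w => by
    rw [one_div]; exact_mod_cast Complex.cpow_nat_inv_pow w two_ne_zero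
  have hc : Continuous (fun z => ratio σ.mat z ^ (1 / 2 : ℂ)) :=
    (continuous_ratio.comp (Continuous.prodMk_right σ.mat)).cpow continuous_const
      (fun z => ratio_mem _ _)
  refine IsPreconnected.eq_of_sq_eq (isPreconnected_univ (α := ℍ)) (f := σ.eta)
    (g := fun z => σ.eta I * ratio σ.mat z ^ (1 / 2 : ℂ)) σ.holo.continuous.continuousOn
    (continuous_const.mul hc).continuousOn ?_ ?_ (Set.mem_univ I) ?_ (Set.mem_univ z)
  · intro z _
    simp only [Pi.pow_apply]
    rw [mul_pow, hsq, σ.eta_sq, σ.eta_sq, ratio, mul_div_cancel₀ _ (denom_ne _ _)]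
  · intro z _
    refine mul_ne_zero (σ.eta_ne _) ?_
    intro h0
    have := hsq (ratio σ.mat z)
    rw [h0] at this
    exact Complex.slitPlane_ne_zero (ratio_mem σ.mat z) (by rw [← this]; simp)
  · have h1 : ratio σ.mat I = 1 := div_self (denom_ne σ.mat I)
    simp [h1]

/-- The element `(g, η)` with `η(i) = w`, where `w² = c i + d`. -/
noncomputable def ofVal (g : SL(2, ℝ)) (w : ℂ)
    (hw : w ^ 2 = (g 1 0 : ℂ) * ((I : ℍ) : ℂ) + (g 1 1 : ℂ)) : Mp2 where
  mat := g
  eta := fun z => w * ratio g z ^ (1 / 2 : ℂ)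
  holo := by
    rw [UpperHalfPlane.mdifferentiable_iff]
    have h : DifferentiableOn ℂ (fun z : ℂ => w * (((g 1 0 : ℂ) * z + (g 1 1 : ℂ)) /
        ((g 1 0 : ℂ) * ((I : ℍ) : ℂ) + (g 1 1 : ℂ))) ^ (1 / 2 : ℂ)) {z | 0 < z.im} := by
      refine DifferentiableOn.const_mul (DifferentiableOn.cpow_const (by fun_prop) ?_) _
      intro z hz
      exact ratio_mem g ⟨z, hz⟩
    refine h.congr fun z hz => ?_
    simp [ratio, ofComplex_apply_of_im_pos hz]
  eta_sq := fun z => by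
    have : (ratio g z ^ (1 / 2 : ℂ)) ^ 2 = ratio g z := by
      rw [one_div]; exact_mod_cast Complex.cpow_nat_inv_pow _ two_ne_zero
    rw [mul_pow, this, hw, ratio, mul_div_cancel₀ _ (denom_ne _ _)]

theorem isClosedEmbedding_val :
    Topology.IsClosedEmbedding (fun σ : Mp2 => (σ.mat, σ.eta I)) := by
  refine ⟨⟨⟨rfl⟩, ?_⟩, ?_⟩
  · intro σ τ h
    obtain ⟨h1, h2⟩ := Prod.mk.inj h
    ext1
    · exact h1
    · funext z
      rw [eta_eq σ z, eta_eq τ z, h1, h2]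
  · have : Set.range (fun σ : Mp2 => (σ.mat, σ.eta I)) =
        {p : SL(2, ℝ) × ℂ | p.2 ^ 2 = (p.1 1 0 : ℂ) * ((I : ℍ) : ℂ) + (p.1 1 1 : ℂ)} := by
      ext ⟨g, w⟩
      constructor
      · rintro ⟨σ, hσ⟩
        obtain ⟨rfl, rfl⟩ := Prod.mk.inj hσ
        exact σ.eta_sq I
      · intro hw
        refine ⟨ofVal g w hw, ?_⟩
        have h1 : ratio g I = 1 := div_self (denom_ne g I)
        simp [ofVal, h1]
    rw [this]
    exact isClosed_eq (by fun_prop) (by fun_prop)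

theorem continuous_mat : Continuous mat :=
  continuous_fst.comp isClosedEmbedding_val.continuous

theorem continuous_eta : Continuous (fun p : Mp2 × ℍ => p.1.eta p.2) := by
  have h : (fun p : Mp2 × ℍ => p.1.eta p.2) =
      fun p => p.1.eta I * ratio p.1.mat p.2 ^ (1 / 2 : ℂ) := by
    funext p; exact eta_eq _ _
  rw [h]
  refine Continuous.mul
    ((continuous_snd.comp isClosedEmbedding_val.continuous).comp continuous_fst) ?_
  exact (continuous_ratio.comp ((continuous_mat.comp continuous_fst).prodMk continuous_snd)).cpow
    continuous_const (fun p => ratio_mem _ _)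

instance : IsTopologicalGroup Mp2 where
  continuous_mul := by
    rw [isClosedEmbedding_val.isInducing.continuous_iff]
    have h1 : Continuous fun p : Mp2 × Mp2 => p.1.mat := continuous_mat.comp continuous_fst
    have h2 : Continuous fun p : Mp2 × Mp2 => p.2.mat := continuous_mat.comp continuous_snd
    refine (h1.mul h2).prodMk (Continuous.mul ?_ ?_)
    · exact continuous_eta.comp (continuous_fst.prodMk (h2.smul continuous_const))
    · exact continuous_eta.comp (continuous_snd.prodMk continuous_const)
  continuous_inv := by
    rw [isClosedEmbedding_val.isInducing.continuous_iff]
    refine continuous_mat.inv.prodMk (Continuous.inv₀ ?_ (fun σ => σ.eta_ne _))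
    exact continuous_eta.comp (continuous_id.prodMk (continuous_mat.inv.smul continuous_const))

instance : LocallyCompactSpace Mp2 := by
  have : LocallyCompactSpace (Matrix (Fin 2) (Fin 2) ℝ) :=
    inferInstanceAs (LocallyCompactSpace (Fin 2 → Fin 2 → ℝ))
  have : LocallyCompactSpace (SL(2, ℝ)) :=
    (Matrix.SpecialLinearGroup.isClosedEmbedding_val (n := Fin 2) (R := ℝ)).locallyCompactSpace
  exact isClosedEmbedding_val.locallyCompactSpace

noncomputable instance : MeasurableSpace Mp2 := borel Mp2
instance : BorelSpace Mp2 := ⟨rfl⟩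

/-- `Γ` has finite covolume: the left action of `Γ` on `Mp2` has a fundamental domain of finite
Haar measure. -/
def HasFiniteCovolume (Γ : Subgroup Mp2) : Prop :=
  ∃ D : Set Mp2, IsFundamentalDomain Γ D (Measure.haar : Measure Mp2) ∧
    (Measure.haar : Measure Mp2) D < ⊤

/-- The image `P(Γ)`, as a group of invertible real matrices. -/
noncomputable def image (Γ : Subgroup Mp2) : Subgroup (GL (Fin 2) ℝ) :=
  (Γ.map proj).map Matrix.SpecialLinearGroup.toGL

/-- `Γ_∞`, the stabilizer of `∞` in `Γ`. -/
noncomputable def stabInfty (Γ : Subgroup Mp2) : Subgroup Mp2 :=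
  Γ ⊓ (MulAction.stabilizer (GL (Fin 2) ℝ) (OnePoint.infty : OnePoint ℝ)).comap
    (Matrix.SpecialLinearGroup.toGL.comp proj)

/-- `N = inf {|c| : (a, b; c, d) ∈ P(Γ ∖ Γ_∞)}`. -/
noncomputable def level (Γ : Subgroup Mp2) : ℝ :=
  sInf {x : ℝ | ∃ γ ∈ Γ, γ ∉ stabInfty Γ ∧ x = |γ.mat 1 0|}

/-- The right action of `Mp2` of weight `m = k + 1/2`:
`(f |_m σ)(z) = f(σ.z) η_σ(z)^{-2m}`. -/
noncomputable def slash (k : ℕ) (f : ℍ → ℂ) (σ : Mp2) (z : ℍ) : ℂ :=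
  f (σ.mat • z) * σ.eta z ^ (-(2 * k + 1) : ℤ)

/-- The `γ`-th term `conj χ(γ) · f |_m γ` of the Poincaré series. -/
noncomputable def poincareTerm (k : ℕ) {Γ : Subgroup Mp2} (χ : Γ →* ℂˣ) (f : ℍ → ℂ)
    (γ : Γ) (z : ℍ) : ℂ :=
  (starRingEnd ℂ) (χ γ : ℂ) * slash k f (γ : Mp2) z

/-- The Poincaré series `∑_{γ ∈ Λ\Γ} conj χ(γ) · f |_m γ`, of weight `m = k + 1/2`, over the
right cosets `Λγ`. Its terms do not depend on the representatives when `χ` is unitary and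
`f |_m λ = χ(λ) f` for `λ ∈ Λ`, see `poincareTerm_mul`. -/
noncomputable def poincareSeries (k : ℕ) {Γ : Subgroup Mp2} (Λ : Subgroup Mp2) (χ : Γ →* ℂˣ)
    (f : ℍ → ℂ) (z : ℍ) : ℂ :=
  ∑' q : Quotient (QuotientGroup.rightRel (Λ.subgroupOf Γ)), poincareTerm k χ f q.out z

theorem poincareTerm_mul (k : ℕ) {Γ : Subgroup Mp2} (χ : Γ →* ℂˣ) (f : ℍ → ℂ)
    (l γ : Γ) (hu : ‖(χ l : ℂ)‖ = 1) (hf : ∀ z, slash k f (l : Mp2) z = χ l * f z) (z : ℍ) :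
    poincareTerm k χ f (l * γ) z = poincareTerm k χ f γ z := by
  have h1 : slash k f ((l * γ : Γ) : Mp2) z =
      slash k f (l : Mp2) ((γ : Mp2).mat • z) * (γ : Mp2).eta z ^ (-(2 * k + 1) : ℤ) := by
    simp only [slash, Subgroup.coe_mul, mul_mat, mul_eta, mul_smul, mul_zpow]
    ring
  have h2 : (starRingEnd ℂ) (χ l : ℂ) * (χ l : ℂ) = 1 := by
    rw [mul_comm, Complex.mul_conj, Complex.normSq_eq_norm_sq, hu]; simp
  unfold poincareTerm
  rw [h1, hf, slash, map_mul, Units.val_mul, map_mul]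
  linear_combination ((starRingEnd ℂ) (χ γ : ℂ) * f ((γ : Mp2).mat • z) *
    (γ : Mp2).eta z ^ (-(2 * k + 1) : ℤ)) * h2

/-- `F(z, s) = ∑_{n ≥ 1} n^{s-1} e^{2πinz/h}`. -/
noncomputable def F (h : ℝ) (s : ℂ) (z : ℍ) : ℂ :=
  ∑' n : ℕ+, (n : ℂ) ^ (s - 1) *
    Complex.exp (2 * (Real.pi : ℂ) * Complex.I * (n : ℂ) * ((z : ℂ) / (h : ℂ)))

/-- `Ψ_{Γ,m,χ,s} = P_{Γ_∞\Γ,χ}(F(·, s))`, of weight `m = k + 1/2`. -/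
noncomputable def Psi (k : ℕ) {Γ : Subgroup Mp2} (χ : Γ →* ℂˣ) (h : ℝ) (s : ℂ) : ℍ → ℂ :=
  poincareSeries k (stabInfty Γ) χ (F h s)

end Mp2

/-!
The proof compares masses over a fundamental domain for the cusp. Put
`φ(z) = |F(z, s)| (im z)^{m/2}`. Weighted by `(im z)^{m/2}`, the term of the Poincaré series at a
coset `Γ_∞ γ` has absolute value `φ(γ z)` (`Mp2.enorm_poincareTerm`), so if `Ψ` vanishes at `z`,
then `φ(z)` is at most the sum of `φ(γ z)` over the nontrivial cosets (`Mp2.weightedF_le_tsum`).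
This is integrated against `dx dy / y²` over the part `C` of the strip `0 ≤ x < h` with `y > 1/N`.
Nontrivial cosets move `C` below height `1/N`, to pieces that are disjoint modulo translation by
`h`, hence (`Mp2.lintegral_tsum_le`)
`∫_{0 ≤ x < h, y > 1/N} φ ≤ ∫_{0 ≤ x < h, y < 1/N} φ`.
The estimates below contradict this inequality. Only pointwise inequalities between sums in `[0, ∞]`
are used, so they also hold where the series diverges and its sum is zero by convention
(`Mp2.enorm_le_tsum_ne`).

* Above height `1/N`: the first Fourier coefficient of `F` bounds `∫_0^h |F(x + iy)| dx` from below
  by `h e^{-2πy/h}`. This leaves an incomplete gamma integral of shape `m/2 - 1` over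
  `(2π/(Nh), ∞)`. The hypothesis on `m` says `2π/(Nh) ≤ (m/2 - 1) - 1/3`, and the median of a gamma
  distribution of shape `a` exceeds `a - 1/3` (`gamma_median`), so the mass above is more than half
  of the full gamma integral (`lt_lintegral_weightedF_high`).
* Below height `1/N`: Poisson summation gives the Lipschitz formula
  `∑_{n ≥ 1} n^{s-1} e^{2πinτ} = Γ(s) ∑_n (2πi(n - τ))^{-s}` (`lipschitz_formula`); integrating its
  right-hand side term by term bounds `∫_0^h |F(x + iy)| dx` by a multiple of `y^{1 - re s}`, with
  the gamma factors of the theorem (`lintegral_qSeries_le`). The displayed hypothesis says that the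
  resulting bound is at most half of the full gamma integral.

That `N > 0` follows from discreteness, in the manner of Shimizu's lemma (`Mp2.exists_pos_le_abs`).
If `Γ = Γ_∞`, then the series has a single term and `F ≠ 0`.
-/

/-! ### The median of the gamma distribution -/

theorem Real.two_mul_add_lt_log_sub_log {v : ℝ} (h0 : 0 < v) (h1 : v < 1) :
    2 * v + 2 / 3 * v ^ 3 < Real.log (1 + v) - Real.log (1 - v) := by
  have hs := Real.hasSum_log_sub_log_of_abs_lt_one (abs_lt.2 ⟨by linarith, h1⟩)
  have := sum_le_hasSum (Finset.range 3) (fun i _ => by positivity) hs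
  simp only [Finset.sum_range_succ, Finset.sum_range_zero] at this
  norm_num at this
  have : 0 < v ^ 5 := by positivity
  linarith

/-- In the variable `y = t ^ (1/3)` the gamma density becomes, up to scaling, the `3b`-th power of
`y ↦ y e^{-y³/3}`, whose mode is `1`; it is larger to the right of the mode than at the mirror
point on the left. -/
theorem rpow_mul_exp_reflect_lt {b y : ℝ} (hb : 0 < b) (h0 : 0 < y) (h1 : y < 1) :
    y ^ (3 * b) * Real.exp (-(b * y ^ 3)) <
      (2 - y) ^ (3 * b) * Real.exp (-(b * (2 - y) ^ 3)) := by
  rw [Real.rpow_def_of_pos h0, Real.rpow_def_of_pos (by linarith), ← Real.exp_add, ← Real.exp_add,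
    Real.exp_lt_exp]
  have := Real.two_mul_add_lt_log_sub_log (v := 1 - y) (by linarith) (by linarith)
  rw [show 1 + (1 - y) = 2 - y by ring, show 1 - (1 - y) = y by ring] at this
  have := mul_lt_mul_of_pos_left this hb
  nlinarith

theorem rpow_cube_subst {b y : ℝ} (hb : 0 < b) (hy : 0 < y) :
    3 * b * y ^ 2 * (Real.exp (-(b * y ^ 3)) * (b * y ^ 3) ^ (b + 1 / 3 - 1)) =
      3 * b * b ^ (b + 1 / 3 - 1) * (y ^ (3 * b) * Real.exp (-(b * y ^ 3))) := by
  have h1 : y ^ (3 * b) = y ^ 2 * (y ^ 3) ^ (b + 1 / 3 - 1) := by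
    rw [← Real.rpow_natCast y 2, ← Real.rpow_natCast y 3, ← Real.rpow_mul hy.le,
      ← Real.rpow_add hy]
    congr 1; push_cast; ring
  rw [Real.mul_rpow hb.le (by positivity), h1]; ring

theorem image_mul_cube {b : ℝ} (hb : 0 < b) {u v : ℝ} (hu : 0 ≤ u) :
    (fun y : ℝ => b * y ^ 3) '' Set.Ioo u v = Set.Ioo (b * u ^ 3) (b * v ^ 3) := by
  ext t
  constructor
  · rintro ⟨y, ⟨h0, h1⟩, rfl⟩
    exact ⟨mul_lt_mul_of_pos_left (pow_lt_pow_left₀ h0 hu (by norm_num)) hb,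
      mul_lt_mul_of_pos_left (pow_lt_pow_left₀ h1 (hu.trans h0.le) (by norm_num)) hb⟩
  · rintro ⟨h0, h1⟩
    have ht : 0 < t / b := div_pos (lt_of_le_of_lt (by positivity) h0) hb
    have hr : ((t / b) ^ (1 / 3 : ℝ)) ^ 3 = t / b := by
      rw [← Real.rpow_natCast, ← Real.rpow_mul ht.le]; norm_num
    have hpos : 0 ≤ (t / b) ^ (1 / 3 : ℝ) := by positivity
    rw [← lt_div_iff₀' hb, ← hr] at h0
    rw [← div_lt_iff₀' hb, ← hr] at h1
    have hv : 0 ≤ v := by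
      by_contra hv
      have : v ^ 3 < 0 := Odd.pow_neg (by decide) (not_le.1 hv)
      have : 0 ≤ ((t / b) ^ (1 / 3 : ℝ)) ^ 3 := by positivity
      linarith
    refine ⟨(t / b) ^ (1 / 3 : ℝ), ⟨lt_of_pow_lt_pow_left₀ 3 hpos h0,
      lt_of_pow_lt_pow_left₀ 3 hv h1⟩, ?_⟩
    simp only [hr]; field_simp

/-- The cube-root substitution in the gamma integral. -/
theorem gamma_cube_change {b : ℝ} (hb : 0 < b) {u v : ℝ} (hu : 0 ≤ u) :
    (∫ t in Set.Ioo (b * u ^ 3) (b * v ^ 3), Real.exp (-t) * t ^ (b + 1 / 3 - 1)) =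
        3 * b * b ^ (b + 1 / 3 - 1) *
          ∫ y in Set.Ioo u v, y ^ (3 * b) * Real.exp (-(b * y ^ 3)) := by
  have hd : ∀ y ∈ Set.Ioo u v,
      HasDerivWithinAt (fun y : ℝ => b * y ^ 3) (3 * b * y ^ 2) (Set.Ioo u v) y := fun y _ => by
    have := ((hasDerivAt_pow 3 y).const_mul b).hasDerivWithinAt (s := Set.Ioo u v)
    convert! this using 1
    push_cast; ring
  have hinj : Set.InjOn (fun y : ℝ => b * y ^ 3) (Set.Ioo u v) := fun x _ y _ hxy =>
    (Odd.strictMono_pow (by decide : Odd 3)).injective (mul_left_cancel₀ hb.ne' hxy)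
  rw [← image_mul_cube hb hu, integral_image_eq_integral_abs_deriv_smul measurableSet_Ioo hd hinj,
    ← integral_const_mul]
  refine setIntegral_congr_fun measurableSet_Ioo fun y hy => ?_
  have hy0 : 0 < y := lt_of_le_of_lt hu hy.1
  simp only [smul_eq_mul]
  rw [abs_of_pos (by positivity), rpow_cube_subst hb hy0]

/-- The median of the gamma distribution of shape `a` exceeds `a - 1/3`: this number is the mode in
the variable `t ^ (1/3)`, and `rpow_mul_exp_reflect_lt` compares the two sides of the mode. -/
theorem gamma_median {a x : ℝ} (hx : 0 < x) (hxa : x ≤ a - 1 / 3) :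
    Real.Gamma a / 2 < ∫ t in Set.Ioi x, Real.exp (-t) * t ^ (a - 1) := by
  have ha : 0 < a := by linarith
  set g : ℝ → ℝ := fun t => Real.exp (-t) * t ^ (a - 1) with hg
  have hgi : IntegrableOn g (Set.Ioi 0) := Real.GammaIntegral_convergent ha
  have hg0 : ∀ t ∈ Set.Ioi (0 : ℝ), 0 ≤ g t := fun t ht =>
    mul_nonneg (Real.exp_pos _).le (Real.rpow_nonneg (le_of_lt ht) _)
  obtain ⟨b, rfl⟩ : ∃ b, a = b + 1 / 3 := ⟨a - 1 / 3, by ring⟩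
  have hb : 0 < b := by linarith
  have hxb : x ≤ b := by linarith
  have hsplit : Real.Gamma (b + 1 / 3) = (∫ t in Set.Ioo 0 b, g t) + ∫ t in Set.Ioi b, g t := by
    rw [Real.Gamma_eq_integral ha, ← integral_Ioc_eq_integral_Ioo, ← setIntegral_union
      (Set.Ioc_disjoint_Ioi le_rfl) measurableSet_Ioi (hgi.mono_set Set.Ioc_subset_Ioi_self)
      (hgi.mono_set (Set.Ioi_subset_Ioi hb.le)), Set.Ioc_union_Ioi_eq_Ioi hb.le]
  have h8 : ∫ t in Set.Ioo b (b * 2 ^ 3), g t ≤ ∫ t in Set.Ioi b, g t :=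
    setIntegral_mono_set (hgi.mono_set (Set.Ioi_subset_Ioi hb.le))
      ((ae_restrict_iff' measurableSet_Ioi).2 (.of_forall fun t ht => hg0 t (hb.trans ht)))
      Set.Ioo_subset_Ioi_self.eventuallyLE
  have hmono : ∫ t in Set.Ioi b, g t ≤ ∫ t in Set.Ioi x, g t :=
    setIntegral_mono_set (hgi.mono_set (Set.Ioi_subset_Ioi hx.le))
      ((ae_restrict_iff' measurableSet_Ioi).2 (.of_forall fun t ht => hg0 t (hx.trans ht)))
      (Set.Ioi_subset_Ioi hxb).eventuallyLE
  set q : ℝ → ℝ := fun y => y ^ (3 * b) * Real.exp (-(b * y ^ 3)) with hq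
  have hqc : Continuous q := by
    refine Continuous.mul (continuous_id.rpow_const fun _ => Or.inr (by positivity)) (by fun_prop)
  -- after scaling, the mode is at `y = 1` and the reflection `y ↦ 2 - y` exchanges the two sides
  have hlt : ∫ y in Set.Ioo 0 1, q y < ∫ y in Set.Ioo 1 2, q y := by
    have hrefl : ∫ y in Set.Ioo (1 : ℝ) 2, q y = ∫ y in Set.Ioo (0 : ℝ) 1, q (2 - y) := by
      rw [← integral_Ioc_eq_integral_Ioo, ← integral_Ioc_eq_integral_Ioo,
        ← intervalIntegral.integral_of_le (by norm_num), ← intervalIntegral.integral_of_le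
        (by norm_num), intervalIntegral.integral_comp_sub_left]
      norm_num
    rw [hrefl, ← integral_Ioc_eq_integral_Ioo, ← integral_Ioc_eq_integral_Ioo,
        ← intervalIntegral.integral_of_le (by norm_num), ← intervalIntegral.integral_of_le
        (by norm_num)]
    refine intervalIntegral.integral_lt_integral_of_continuousOn_of_le_of_exists_lt one_pos
      hqc.continuousOn (hqc.comp (by fun_prop)).continuousOn (fun y hy => ?_) ?_
    · rcases hy.2.eq_or_lt with rfl | h
      · norm_num
      · exact (rpow_mul_exp_reflect_lt hb hy.1 h).le
    · exact ⟨1 / 2, ⟨by norm_num, by norm_num⟩,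
        rpow_mul_exp_reflect_lt hb (by norm_num) (by norm_num)⟩
  have hK : 0 < 3 * b * b ^ (b + 1 / 3 - 1) := by positivity
  have := mul_lt_mul_of_pos_left hlt hK
  have e1' : ∫ t in Set.Ioo 0 b, g t = 3 * b * b ^ (b + 1 / 3 - 1) * ∫ y in Set.Ioo 0 1, q y := by
    simpa [hg, hq] using gamma_cube_change hb (u := 0) (v := 1) le_rfl
  have e2' : ∫ t in Set.Ioo b (b * 2 ^ 3), g t =
      3 * b * b ^ (b + 1 / 3 - 1) * ∫ y in Set.Ioo 1 2, q y := by
    simpa [hg, hq] using gamma_cube_change hb (u := 1) (v := 2) zero_le_one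
  rw [← e1', ← e2'] at this
  rw [hsplit]
  change _ < ∫ t in Set.Ioi x, g t
  linarith only [this, h8, hmono]

/-! ### The Laplace transform of a complex power -/

theorem integrableOn_rpow_mul_exp_neg_mul {p b : ℝ} (hp : -1 < p) (hb : 0 < b) :
    IntegrableOn (fun t : ℝ => t ^ p * Real.exp (-(b * t))) (Set.Ioi 0) := by
  simpa using integrableOn_rpow_mul_exp_neg_mul_rpow (p := 1) hp one_pos hb

theorem norm_cpow_mul_exp {s r : ℂ} {t : ℝ} (ht : 0 < t) :
    ‖(t : ℂ) ^ (s - 1) * Complex.exp (-(r * t))‖ = t ^ (s.re - 1) * Real.exp (-(r.re * t)) := by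
  rw [norm_mul, Complex.norm_cpow_eq_rpow_re_of_pos ht, Complex.norm_exp]
  simp

theorem aestronglyMeasurable_cpow_mul_exp (s r : ℂ) :
    AEStronglyMeasurable (fun t : ℝ => (t : ℂ) ^ (s - 1) * Complex.exp (-(r * t)))
      (volume.restrict (Set.Ioi 0)) := by
  refine ContinuousOn.aestronglyMeasurable ?_ measurableSet_Ioi
  refine ContinuousOn.mul (fun t ht => ?_) (by fun_prop)
  exact (Complex.continuousAt_ofReal_cpow_const _ _ (Or.inr (ne_of_gt ht))).continuousWithinAt

theorem hasDerivAt_laplace_cpow {s : ℂ} (hs : 0 < s.re) {r : ℂ} (hr : 0 < r.re) :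
    HasDerivAt (fun r : ℂ => ∫ t : ℝ in Set.Ioi 0, (t : ℂ) ^ (s - 1) * Complex.exp (-(r * t)))
      (∫ t : ℝ in Set.Ioi 0, -((t : ℂ) * ((t : ℂ) ^ (s - 1) * Complex.exp (-(r * t))))) r := by
  have hhalf : 0 < r.re / 2 := by linarith
  refine (hasDerivAt_integral_of_dominated_loc_of_deriv_le (𝕜 := ℂ)
    (F := fun r (t : ℝ) => (t : ℂ) ^ (s - 1) * Complex.exp (-(r * t)))
    (F' := fun r (t : ℝ) => -((t : ℂ) * ((t : ℂ) ^ (s - 1) * Complex.exp (-(r * t)))))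
    (bound := fun t => t ^ s.re * Real.exp (-(r.re / 2 * t)))
    (Metric.ball_mem_nhds r hhalf) ?_ ?_ ?_ ?_ ?_ ?_).2
  · exact .of_forall fun r => aestronglyMeasurable_cpow_mul_exp s r
  · refine Integrable.mono' (integrableOn_rpow_mul_exp_neg_mul (by linarith : -1 < s.re - 1) hr)
      (aestronglyMeasurable_cpow_mul_exp s r) ?_
    refine (ae_restrict_iff' measurableSet_Ioi).2 (.of_forall fun t ht => ?_)
    rw [norm_cpow_mul_exp ht]
  · exact (Complex.continuous_ofReal.aestronglyMeasurable.mul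
      (aestronglyMeasurable_cpow_mul_exp s r)).neg
  · refine (ae_restrict_iff' measurableSet_Ioi).2 (.of_forall fun t ht q hq => ?_)
    have ht' : (0 : ℝ) < t := ht
    have hre : r.re / 2 ≤ q.re := by
      have h1 := (Complex.abs_re_le_norm (q - r)).trans_lt (mem_ball_iff_norm.1 hq)
      rw [Complex.sub_re, abs_lt] at h1
      linarith
    rw [norm_neg, norm_mul, norm_cpow_mul_exp ht, Complex.norm_real, Real.norm_of_nonneg ht'.le,
      ← mul_assoc]
    have : t * t ^ (s.re - 1) = t ^ s.re := by
      rw [Real.rpow_sub_one ht'.ne']; field_simp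
    rw [this]
    gcongr
  · exact integrableOn_rpow_mul_exp_neg_mul (by linarith) hhalf
  · refine .of_forall fun t q _ => ?_
    have h1 : HasDerivAt (fun q : ℂ => -(q * (t : ℂ))) (-(t : ℂ)) q := by
      simpa using (hasDerivAt_id q).neg.mul_const (t : ℂ) |>.congr_of_eventuallyEq
        (.of_forall fun q => (neg_mul q (t : ℂ)).symm)
    convert! h1.cexp.const_mul ((t : ℂ) ^ (s - 1)) using 1
    ring

/-- The Laplace transform of `t ^ (s - 1)`, by analytic continuation from the positive real
axis. -/
theorem laplace_cpow {s : ℂ} (hs : 0 < s.re) {r : ℂ} (hr : 0 < r.re) :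
    ∫ t : ℝ in Set.Ioi 0, (t : ℂ) ^ (s - 1) * Complex.exp (-(r * t)) =
      (1 / r) ^ s * Complex.Gamma s := by
  have hopen : IsOpen {r : ℂ | 0 < r.re} := isOpen_lt continuous_const Complex.continuous_re
  have hA : AnalyticOnNhd ℂ
      (fun r : ℂ => ∫ t : ℝ in Set.Ioi 0, (t : ℂ) ^ (s - 1) * Complex.exp (-(r * t)))
      {r : ℂ | 0 < r.re} := DifferentiableOn.analyticOnNhd (fun r hr =>
    (hasDerivAt_laplace_cpow hs hr).differentiableAt.differentiableWithinAt) hopen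
  have hB : AnalyticOnNhd ℂ (fun r : ℂ => (1 / r) ^ s * Complex.Gamma s) {r : ℂ | 0 < r.re} := by
    refine DifferentiableOn.analyticOnNhd (fun r hr => ?_) hopen
    have hr0 : r ≠ 0 := by rintro rfl; simp at hr
    refine DifferentiableAt.differentiableWithinAt ?_
    refine DifferentiableAt.mul_const (DifferentiableAt.cpow ?_ (by fun_prop) ?_) _
    · exact (differentiableAt_const _).div differentiableAt_id hr0
    · left
      rw [one_div, Complex.inv_re]
      exact div_pos hr (Complex.normSq_pos.2 hr0)
  have hconv : IsPreconnected {r : ℂ | 0 < r.re} :=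
    (convex_halfSpace_re_gt 0).isPreconnected
  refine hA.eqOn_of_preconnected_of_frequently_eq hB hconv (z₀ := 1) (by simp) ?_ hr
  have hmap : Filter.Tendsto (fun x : ℝ => (x : ℂ)) (𝓝[≠] 1) (𝓝[≠] 1) := by
    refine tendsto_nhdsWithin_iff.2 ⟨?_, ?_⟩
    · exact (Complex.continuous_ofReal.tendsto' 1 1 (by simp)).mono_left nhdsWithin_le_nhds
    · filter_upwards [self_mem_nhdsWithin] with x hx
      simpa using hx
  refine hmap.frequently (Filter.Eventually.frequently ?_)
  filter_upwards [nhdsWithin_le_nhds (lt_mem_nhds one_pos)] with x hx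
  exact Complex.integral_cpow_mul_exp_neg_mul_Ioi hs hx

/-- The argument of a point of the right half-plane is at most `π / 2`; this is the origin of the
factor `e^{π|im s|/2}`. -/
theorem norm_one_div_cpow_le {s r : ℂ} (hr : 0 < r.re) :
    ‖(1 / r) ^ s‖ ≤ Real.exp (Real.pi / 2 * |s.im|) * ‖r‖ ^ (-s.re) := by
  have hr0 : r ≠ 0 := by rintro rfl; simp at hr
  have h0 : 1 / r ≠ 0 := one_div_ne_zero hr0
  have hre : 0 ≤ (1 / r).re := by
    rw [one_div, Complex.inv_re]; exact div_nonneg hr.le (Complex.normSq_nonneg _)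
  rw [Complex.norm_cpow_of_ne_zero h0, norm_div, norm_one, one_div,
    Real.inv_rpow (norm_nonneg _), ← Real.rpow_neg (norm_nonneg _), div_eq_mul_inv,
    ← Real.exp_neg, mul_comm]
  gcongr
  have h2 : |Complex.arg r⁻¹| ≤ Real.pi / 2 :=
    Complex.abs_arg_le_pi_div_two_iff.2 (by simpa using hre)
  rw [one_div]
  calc -(Complex.arg r⁻¹ * s.im) ≤ |Complex.arg r⁻¹ * s.im| := neg_le_abs _
    _ = |Complex.arg r⁻¹| * |s.im| := abs_mul _ _
    _ ≤ Real.pi / 2 * |s.im| := by gcongr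

theorem norm_Gamma_le_Gamma_re {s : ℂ} (hs : 0 < s.re) :
    ‖Complex.Gamma s‖ ≤ Real.Gamma s.re := by
  rw [Complex.Gamma_eq_integral hs, Complex.GammaIntegral, Real.Gamma_eq_integral hs]
  refine (norm_integral_le_integral_norm _).trans_eq ?_
  refine setIntegral_congr_fun measurableSet_Ioi fun t ht => ?_
  simp only [norm_mul, Complex.norm_cpow_eq_rpow_re_of_pos ht, Complex.norm_real]
  rw [Real.norm_of_nonneg (Real.exp_pos _).le]
  simp

/-! ### A Lipschitz-type summation formula -/

/-- The extension of `t ↦ t ^ (s - 1) e^{2πiτt}` by zero to the negative axis. -/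
noncomputable def lipschitzFun (s τ : ℂ) (t : ℝ) : ℂ :=
  ((max t 0 : ℝ) : ℂ) ^ (s - 1) * Complex.exp (2 * Real.pi * Complex.I * t * τ)

theorem lipschitzFun_of_nonpos {s τ : ℂ} (hs : 1 < s.re) {t : ℝ} (ht : t ≤ 0) :
    lipschitzFun s τ t = 0 := by
  have : s - 1 ≠ 0 := fun h => by
    have := congrArg Complex.re h
    simp at this; linarith
  simp [lipschitzFun, max_eq_right ht, Complex.zero_cpow this]

theorem continuous_lipschitzFun {s τ : ℂ} (hs : 1 < s.re) : Continuous (lipschitzFun s τ) := by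
  refine Continuous.mul ?_ (by fun_prop)
  exact (Complex.continuous_ofReal_cpow_const (y := s - 1) (by simpa using hs)).comp
    (continuous_id.max continuous_const)

theorem lipschitzFun_isBigO {s τ : ℂ} (hs : 1 < s.re) (hτ : 0 < τ.im) :
    lipschitzFun s τ =O[Filter.cocompact ℝ] fun x : ℝ => |x| ^ (-2 : ℝ) := by
  rw [cocompact_eq_atBot_atTop, Asymptotics.isBigO_sup]
  constructor
  · refine Asymptotics.IsBigO.of_bound 1 ?_
    filter_upwards [Filter.eventually_le_atBot 0] with t ht
    rw [lipschitzFun_of_nonpos hs ht]; simp; positivity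
  · have h1 := (isLittleO_exp_neg_mul_rpow_atTop (a := 2 * Real.pi * τ.im) (by positivity)
      (-2 - (s.re - 1))).isBigO
    refine Asymptotics.IsBigO.trans ?_
      ((Asymptotics.isBigO_refl (fun t : ℝ => t ^ (s.re - 1)) Filter.atTop).mul h1 |>.trans ?_)
    · refine Asymptotics.IsBigO.of_bound 1 ?_
      filter_upwards [Filter.eventually_gt_atTop 0] with t ht
      rw [lipschitzFun, max_eq_left ht.le, norm_mul, Complex.norm_cpow_eq_rpow_re_of_pos ht,
        Complex.norm_exp, one_mul, norm_mul, Real.norm_of_nonneg (by positivity),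
        Real.norm_of_nonneg (by positivity)]
      simp
      apply le_of_eq; congr 2; ring
    · refine Asymptotics.IsBigO.of_bound 1 ?_
      filter_upwards [Filter.eventually_gt_atTop 0] with t ht
      rw [← Real.rpow_add ht, abs_of_pos ht, one_mul]
      apply le_of_eq; congr 2; ring

open FourierTransform in
theorem fourier_lipschitzFun {s τ : ℂ} (hs : 1 < s.re) (hτ : 0 < τ.im) (w : ℝ) :
    𝓕 (lipschitzFun s τ) w =
      (1 / (2 * Real.pi * Complex.I * (w - τ))) ^ s * Complex.Gamma s := by
  rw [← laplace_cpow (by linarith) (by simpa using mul_pos Real.two_pi_pos hτ),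
    Real.fourier_real_eq_integral_exp_smul,
    ← setIntegral_eq_integral_of_forall_compl_eq_zero (s := Set.Ioi 0)]
  · refine setIntegral_congr_fun measurableSet_Ioi fun t ht => ?_
    have ht' : (0 : ℝ) < t := ht
    simp only [lipschitzFun, max_eq_left ht'.le, smul_eq_mul]
    rw [mul_left_comm, ← Complex.exp_add]
    congr 2
    push_cast; ring
  · intro t ht
    rw [lipschitzFun_of_nonpos hs (not_lt.1 ht), smul_zero]

theorem norm_fourier_lipschitz_le {s τ : ℂ} (hs : 1 < s.re) (hτ : 0 < τ.im) (w : ℝ) :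
    ‖(1 / (2 * Real.pi * Complex.I * (w - τ))) ^ s * Complex.Gamma s‖ ≤
      Real.exp (Real.pi / 2 * |s.im|) * (2 * Real.pi) ^ (-s.re) * Real.Gamma s.re *
        ‖(w : ℂ) - τ‖ ^ (-s.re) := by
  have hr : 0 < (2 * Real.pi * Complex.I * (w - τ)).re := by
    simpa using mul_pos Real.two_pi_pos hτ
  have hn : ‖2 * Real.pi * Complex.I * (w - τ)‖ = 2 * Real.pi * ‖(w : ℂ) - τ‖ := by
    simp [abs_of_pos Real.pi_pos]
  have h1 := norm_one_div_cpow_le (s := s) hr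
  rw [hn, Real.mul_rpow (by positivity) (norm_nonneg _)] at h1
  rw [norm_mul]
  calc _ ≤ (Real.exp (Real.pi / 2 * |s.im|) *
        ((2 * Real.pi) ^ (-s.re) * ‖(w : ℂ) - τ‖ ^ (-s.re))) * Real.Gamma s.re :=
        mul_le_mul h1 (norm_Gamma_le_Gamma_re (by linarith)) (norm_nonneg _) (by positivity)
    _ = _ := by ring

/-- The Lipschitz summation formula, from Poisson summation for `lipschitzFun`. -/
theorem lipschitz_formula {s τ : ℂ} (hs : 1 < s.re) (hτ : 0 < τ.im) :
    ∑' n : ℕ+, (n : ℂ) ^ (s - 1) * Complex.exp (2 * Real.pi * Complex.I * n * τ) =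
      ∑' n : ℤ, (1 / (2 * Real.pi * Complex.I * (n - τ))) ^ s * Complex.Gamma s := by
  have hdecay : (fun w : ℝ => (1 / (2 * Real.pi * Complex.I * (w - τ))) ^ s * Complex.Gamma s)
      =O[Filter.cocompact ℝ] fun x : ℝ => |x| ^ (-s.re) := by
    refine Asymptotics.IsBigO.of_bound (Real.exp (Real.pi / 2 * |s.im|) * (2 * Real.pi) ^ (-s.re) *
      Real.Gamma s.re * (1 / 2) ^ (-s.re)) ?_
    filter_upwards [(tendsto_norm_cocompact_atTop (E := ℝ)).eventually_ge_atTop (2 * ‖τ‖ + 1)]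
      with w hw
    refine (norm_fourier_lipschitz_le hs hτ w).trans ?_
    rw [Real.norm_of_nonneg (by positivity), mul_assoc _ ((1 / 2 : ℝ) ^ (-s.re)),
      ← Real.mul_rpow (by norm_num) (abs_nonneg _)]
    rw [Real.norm_eq_abs] at hw
    have h1 : 1 / 2 * |w| ≤ ‖(w : ℂ) - τ‖ := by
      have := norm_sub_norm_le (w : ℂ) τ
      rw [Complex.norm_real, Real.norm_eq_abs] at this
      linarith
    have h2 : 0 < |w| := by have := norm_nonneg τ; linarith
    have hG : 0 < Real.Gamma s.re := Real.Gamma_pos_of_pos (by linarith)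
    refine mul_le_mul_of_nonneg_left ?_ (by positivity)
    exact Real.rpow_le_rpow_of_nonpos (by positivity) h1 (by linarith)
  have hcong : (fun w : ℝ => FourierTransform.fourier (lipschitzFun s τ) w) =
      (fun w : ℝ => (1 / (2 * Real.pi * Complex.I * (w - τ))) ^ s * Complex.Gamma s) :=
    funext (fourier_lipschitzFun hs hτ)
  have hb : 1 < min 2 s.re := lt_min (by norm_num) hs
  have hweak : ∀ p : ℝ, min 2 s.re ≤ p → (fun x : ℝ => |x| ^ (-p)) =O[Filter.cocompact ℝ]
      fun x : ℝ => |x| ^ (-(min 2 s.re)) := fun p hp => by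
    refine Asymptotics.IsBigO.of_bound 1 ?_
    filter_upwards [(tendsto_norm_cocompact_atTop (E := ℝ)).eventually_ge_atTop 1] with w hw
    rw [Real.norm_of_nonneg (by positivity), Real.norm_of_nonneg (by positivity), one_mul]
    exact Real.rpow_le_rpow_of_exponent_le hw (by linarith)
  have hP := Real.tsum_eq_tsum_fourier_of_rpow_decay (continuous_lipschitzFun (τ := τ) hs) hb
    ((lipschitzFun_isBigO hs hτ).trans (hweak 2 (min_le_left _ _)))
    ((hcong ▸ hdecay).trans (hweak s.re (min_le_right _ _))) 0
  have hL : ∑' n : ℤ, lipschitzFun s τ (0 + n) =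
      ∑' n : ℕ+, (n : ℂ) ^ (s - 1) * Complex.exp (2 * Real.pi * Complex.I * n * τ) := by
    have hinj : Function.Injective (fun n : ℕ+ => ((n : ℕ) : ℤ)) := fun a b h => by
      exact PNat.coe_injective (Int.ofNat_injective h)
    rw [← hinj.tsum_eq]
    · refine tsum_congr fun n => ?_
      have : (0 : ℝ) < (n : ℕ) := by exact_mod_cast n.pos
      simp [lipschitzFun]
    · intro n hn
      have : 0 < n := by
        by_contra hneg
        refine hn (lipschitzFun_of_nonpos hs ?_)
        have : n ≤ 0 := not_lt.1 hneg
        simpa using this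
      exact ⟨⟨n.toNat, by omega⟩, by simp [this.le]⟩
  rw [← hL, hP]
  refine tsum_congr fun n => ?_
  rw [fourier_lipschitzFun hs hτ]
  simp

/-! ### Rows of the `q`-series -/

/-- Writing `Γ(p) A^{-p}` as a gamma integral reduces this to Gaussian integrals. -/
theorem lintegral_sq_add_sq_rpow {y p : ℝ} (hy : 0 < y) (hp : 1 / 2 < p) :
    ∫⁻ u : ℝ, ENNReal.ofReal ((u ^ 2 + y ^ 2) ^ (-p)) =
      ENNReal.ofReal (√Real.pi * Real.Gamma (p - 1 / 2) / Real.Gamma p * y ^ (1 - 2 * p)) := by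
  have hG : 0 < Real.Gamma p := Real.Gamma_pos_of_pos (by linarith)
  have hG' : 0 < Real.Gamma (p - 1 / 2) := Real.Gamma_pos_of_pos (by linarith)
  have h1 : ∀ u : ℝ, ENNReal.ofReal ((u ^ 2 + y ^ 2) ^ (-p)) =
      ENNReal.ofReal (1 / Real.Gamma p) * ∫⁻ t in Set.Ioi (0 : ℝ),
        ENNReal.ofReal (t ^ (p - 1) * Real.exp (-((u ^ 2 + y ^ 2) * t))) := fun u => by
    have hA : 0 < u ^ 2 + y ^ 2 := by positivity
    rw [← ofReal_integral_eq_lintegral_ofReal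
      (integrableOn_rpow_mul_exp_neg_mul (by linarith) hA)
      ((ae_restrict_iff' measurableSet_Ioi).2 (.of_forall fun t (ht : 0 < t) => by positivity)),
      Real.integral_rpow_mul_exp_neg_mul_Ioi (by linarith) hA,
      ← ENNReal.ofReal_mul (by positivity), one_div (u ^ 2 + y ^ 2), Real.inv_rpow hA.le,
      ← Real.rpow_neg hA.le]
    congr 1; field_simp
  have hmeas : Measurable (Function.uncurry fun u t : ℝ =>
      ENNReal.ofReal (t ^ (p - 1) * Real.exp (-((u ^ 2 + y ^ 2) * t)))) := by
    unfold Function.uncurry; fun_prop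
  have hgauss : ∀ t ∈ Set.Ioi (0 : ℝ), ∫⁻ u : ℝ,
      ENNReal.ofReal (t ^ (p - 1) * Real.exp (-((u ^ 2 + y ^ 2) * t))) =
      ENNReal.ofReal (√Real.pi) *
        ENNReal.ofReal (t ^ (p - 1 / 2 - 1) * Real.exp (-(y ^ 2 * t))) := fun t (ht : 0 < t) => by
    have : ∀ u : ℝ, ENNReal.ofReal (t ^ (p - 1) * Real.exp (-((u ^ 2 + y ^ 2) * t))) =
        ENNReal.ofReal (t ^ (p - 1) * Real.exp (-(y ^ 2 * t))) *
          ENNReal.ofReal (Real.exp (-t * u ^ 2)) := fun u => by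
      rw [← ENNReal.ofReal_mul (by positivity), mul_assoc, ← Real.exp_add]
      congr 3; ring
    simp_rw [this]
    rw [lintegral_const_mul _ (by fun_prop), ← ofReal_integral_eq_lintegral_ofReal
      (integrable_exp_neg_mul_sq ht) (.of_forall fun _ => (Real.exp_pos _).le), integral_gaussian,
      ← ENNReal.ofReal_mul (by positivity), ← ENNReal.ofReal_mul (by positivity)]
    congr 1
    rw [Real.sqrt_div Real.pi_pos.le, show p - 1 / 2 - 1 = (p - 1) - 1 / 2 by ring,
      Real.rpow_sub ht (p - 1), ← Real.sqrt_eq_rpow]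
    ring
  simp_rw [h1]
  rw [lintegral_const_mul _ (by exact Measurable.lintegral_prod_right' hmeas),
    lintegral_lintegral_swap hmeas.aemeasurable, setLIntegral_congr_fun measurableSet_Ioi hgauss,
    lintegral_const_mul _ (by fun_prop), ← ofReal_integral_eq_lintegral_ofReal
      (integrableOn_rpow_mul_exp_neg_mul (by linarith) (by positivity))
      ((ae_restrict_iff' measurableSet_Ioi).2 (.of_forall fun t (ht : 0 < t) => by positivity)),
    Real.integral_rpow_mul_exp_neg_mul_Ioi (by linarith) (by positivity),
    ← ENNReal.ofReal_mul (by positivity), ← ENNReal.ofReal_mul (by positivity)]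
  congr 1
  have : (1 / y ^ 2) ^ (p - 1 / 2) = y ^ (1 - 2 * p) := by
    rw [one_div, ← Real.rpow_natCast, ← Real.rpow_neg hy.le, ← Real.rpow_mul hy.le]
    congr 1; push_cast; ring
  rw [this]; ring

theorem lintegral_Ico_tsum_int (f : ℝ → ENNReal) (hf : Measurable f) :
    ∫⁻ x in Set.Ico (0 : ℝ) 1, ∑' n : ℤ, f (x + n) = ∫⁻ x, f x := by
  rw [lintegral_tsum (f := fun (n : ℤ) x => f (x + n))
      (fun n => (hf.comp (measurable_add_const _)).aemeasurable),
    ← setLIntegral_univ f, ← iUnion_Ico_intCast ℝ,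
    lintegral_iUnion (fun _ => measurableSet_Ico) (Set.pairwise_disjoint_Ico_intCast ℝ)]
  refine tsum_congr fun n => ?_
  rw [← (measurePreserving_add_right volume (n : ℝ)).setLIntegral_comp_preimage
    measurableSet_Ico hf]
  simp [Set.preimage_add_const_Ico]

/-- The series `∑_{n ≥ 1} n^{s-1} e^{2πinτ}`, so that `F h s z = qSeries s (z / h)`. -/
noncomputable def qSeries (s τ : ℂ) : ℂ :=
  ∑' n : ℕ+, (n : ℂ) ^ (s - 1) * Complex.exp (2 * Real.pi * Complex.I * n * τ)

theorem enorm_qSeries_le {s τ : ℂ} (hs : 1 < s.re) (hτ : 0 < τ.im) :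
    ‖qSeries s τ‖ₑ ≤ ENNReal.ofReal
      (Real.exp (Real.pi / 2 * |s.im|) * (2 * Real.pi) ^ (-s.re) * Real.Gamma s.re) *
      ∑' n : ℤ, ENNReal.ofReal (((τ.re + n) ^ 2 + τ.im ^ 2) ^ (-(s.re / 2))) := by
  have hG : 0 < Real.Gamma s.re := Real.Gamma_pos_of_pos (by linarith)
  rw [qSeries, lipschitz_formula hs hτ, ← ENNReal.tsum_mul_left,
    ← (Equiv.neg ℤ).tsum_eq (fun n : ℤ => _ * ENNReal.ofReal _)]
  refine (enorm_tsum_le_tsum_enorm).trans (ENNReal.tsum_le_tsum fun n => ?_)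
  rw [← ENNReal.ofReal_mul (by positivity), ← ofReal_norm]
  refine ENNReal.ofReal_le_ofReal ?_
  have := norm_fourier_lipschitz_le hs hτ n
  push_cast at this
  refine this.trans_eq ?_
  congr 1
  have h2 : ‖(n : ℂ) - τ‖ ^ 2 = (τ.re + ((Equiv.neg ℤ n : ℤ) : ℝ)) ^ 2 + τ.im ^ 2 := by
    rw [← Complex.normSq_eq_norm_sq, Complex.normSq_apply]
    simp; ring
  rw [← h2, ← Real.rpow_natCast, ← Real.rpow_mul (norm_nonneg _)]
  congr 1; push_cast; ring

/-- Summing the Lipschitz formula over a period unfolds to an integral over the real line; the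
duplication formula then simplifies the gamma factors. -/
theorem lintegral_qSeries_le {s : ℂ} (hs : 1 < s.re) {y : ℝ} (hy : 0 < y) :
    ∫⁻ x in Set.Ico (0 : ℝ) 1, ‖qSeries s (x + y * Complex.I)‖ₑ ≤
      ENNReal.ofReal (1 / 2 * Real.pi ^ (-s.re) * (Real.exp (Real.pi / 2 * |s.im|) *
        Real.Gamma ((s.re + 1) / 2) * Real.Gamma ((s.re - 1) / 2)) * y ^ (1 - s.re)) := by
  have hG : 0 < Real.Gamma s.re := Real.Gamma_pos_of_pos (by linarith)
  have hG2 : 0 < Real.Gamma (s.re / 2) := Real.Gamma_pos_of_pos (by linarith)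
  calc _ ≤ ∫⁻ x in Set.Ico (0 : ℝ) 1, ENNReal.ofReal
        (Real.exp (Real.pi / 2 * |s.im|) * (2 * Real.pi) ^ (-s.re) * Real.Gamma s.re) *
        ∑' n : ℤ, ENNReal.ofReal (((x + n) ^ 2 + y ^ 2) ^ (-(s.re / 2))) := by
        refine lintegral_mono fun x => ?_
        simpa using enorm_qSeries_le (τ := x + y * Complex.I) hs (by simpa using hy)
    _ = _ := by
        have hm : Measurable fun u : ℝ => ENNReal.ofReal ((u ^ 2 + y ^ 2) ^ (-(s.re / 2))) := by
          fun_prop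
        rw [lintegral_const_mul _ (by fun_prop), lintegral_Ico_tsum_int _ hm,
          lintegral_sq_add_sq_rpow hy (by linarith), ← ENNReal.ofReal_mul (by positivity)]
        congr 1
        have hd := Real.Gamma_mul_Gamma_add_half (s.re / 2)
        rw [show 2 * (s.re / 2) = s.re by ring] at hd
        rw [show (s.re + 1) / 2 = s.re / 2 + 1 / 2 by ring,
          show (s.re - 1) / 2 = s.re / 2 - 1 / 2 by ring,
          show 2 * (s.re / 2) = s.re by ring, Real.mul_rpow zero_le_two Real.pi_pos.le]
        have h2 : (2 : ℝ) ^ (1 - s.re) = 2 * 2 ^ (-s.re) := by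
          rw [sub_eq_add_neg, Real.rpow_add two_pos, Real.rpow_one]
        rw [h2] at hd
        have h3 : Real.Gamma s.re * 2 ^ (-s.re) * √Real.pi / Real.Gamma (s.re / 2) =
            Real.Gamma (s.re / 2 + 1 / 2) / 2 := by
          rw [div_eq_div_iff hG2.ne' two_ne_zero]
          linear_combination (-1 : ℝ) * hd
        linear_combination (Real.exp (Real.pi / 2 * |s.im|) * Real.pi ^ (-s.re) *
          Real.Gamma (s.re / 2 - 1 / 2) * y ^ (1 - s.re)) * h3

theorem norm_qSeries_term (s τ : ℂ) (n : ℕ+) :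
    ‖(n : ℂ) ^ (s - 1) * Complex.exp (2 * Real.pi * Complex.I * n * τ)‖ =
      (n : ℝ) ^ (s.re - 1) * Real.exp (-(2 * Real.pi * τ.im)) ^ (n : ℕ) := by
  have hn : (0 : ℝ) < (n : ℕ) := by exact_mod_cast n.pos
  have := Complex.norm_cpow_eq_rpow_re_of_pos hn (s - 1)
  simp only [Complex.ofReal_natCast] at this
  rw [norm_mul, this, Complex.norm_exp, ← Real.exp_nat_mul]
  simp; left; ring

theorem summable_rpow_mul_geometric (p : ℝ) {r : ℝ} (h0 : 0 ≤ r) (h1 : r < 1) :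
    Summable fun n : ℕ+ => (n : ℝ) ^ p * r ^ (n : ℕ) := by
  obtain ⟨j, hj⟩ := exists_nat_ge p
  have h := (summable_pow_mul_geometric_of_norm_lt_one j
    (by rwa [Real.norm_of_nonneg h0] : ‖r‖ < 1)).comp_injective PNat.coe_injective
  refine h.of_nonneg_of_le (fun n => by positivity) fun n => ?_
  have hn : (1 : ℝ) ≤ (n : ℕ) := by exact_mod_cast Nat.one_le_iff_ne_zero.2 n.ne_zero
  simp only [Function.comp]
  gcongr
  rw [← Real.rpow_natCast]
  exact Real.rpow_le_rpow_of_exponent_le hn hj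

theorem qSeries_add_int (s τ : ℂ) (j : ℤ) : qSeries s (τ + j) = qSeries s τ := by
  refine tsum_congr fun n => ?_
  rw [mul_add, Complex.exp_add]
  have : Complex.exp (2 * Real.pi * Complex.I * n * j) = 1 :=
    Complex.exp_eq_one_iff.2 ⟨n * j, by push_cast; ring⟩
  rw [this, mul_one]

@[fun_prop]
theorem measurable_qSeries (s : ℂ) : Measurable (qSeries s) :=
  Measurable.tsum fun n => by fun_prop

theorem integral_exp_two_pi_int (n : ℤ) :
    ∫ x in Set.Ico (0 : ℝ) 1, Complex.exp (2 * Real.pi * Complex.I * n * x) =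
      if n = 0 then 1 else 0 := by
  rw [integral_Ico_eq_integral_Ioc, ← intervalIntegral.integral_of_le zero_le_one]
  split_ifs with hn
  · simp [hn]
  · have : (2 * Real.pi * Complex.I * n : ℂ) ≠ 0 := by simp [hn, Real.pi_ne_zero]
    have h1 : Complex.exp (2 * Real.pi * Complex.I * n * (1 : ℝ)) = 1 :=
      Complex.exp_eq_one_iff.2 ⟨n, by push_cast; ring⟩
    rw [integral_exp_mul_complex this, h1]
    simp

/-- The first Fourier coefficient bounds the `L¹` norm of a row from below. -/
theorem le_lintegral_qSeries {s : ℂ} {y : ℝ} (hy : 0 < y) :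
    ENNReal.ofReal (Real.exp (-(2 * Real.pi * y))) ≤
      ∫⁻ x in Set.Ico (0 : ℝ) 1, ‖qSeries s (x + y * Complex.I)‖ₑ := by
  let G : ℕ+ → ℝ → ℂ := fun n x =>
    (n : ℂ) ^ (s - 1) * Complex.exp (2 * Real.pi * Complex.I * n * (x + y * Complex.I)) *
      Complex.exp (-(2 * Real.pi * Complex.I * x))
  have hnorm : ∀ n x, ‖G n x‖ = (n : ℝ) ^ (s.re - 1) * Real.exp (-(2 * Real.pi * y)) ^ (n : ℕ) :=
    fun n x => by
      have := norm_qSeries_term s (x + y * Complex.I) n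
      rw [norm_mul, this, Complex.norm_exp]
      simp
  have hI : ∀ n, IntegrableOn (G n) (Set.Ico (0 : ℝ) 1) := fun n => by
    have hc : Continuous (G n) := by fun_prop
    exact (hc.integrableOn_Icc (a := 0) (b := 1)).mono_set Set.Ico_subset_Icc_self
  have hsum := (hasSum_integral_of_summable_integral_norm hI (by
    simp_rw [hnorm]
    simpa using summable_rpow_mul_geometric (s.re - 1) (Real.exp_pos (-(2 * Real.pi * y))).le
      (Real.exp_lt_one_iff.2 (by have := mul_pos Real.two_pi_pos hy; linarith)))).tsum_eq
  have hcoef : ∀ n : ℕ+, ∫ x in Set.Ico (0 : ℝ) 1, G n x =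
      if n = 1 then (Real.exp (-(2 * Real.pi * y)) : ℂ) else 0 := fun n => by
    have : ∀ x : ℝ, G n x = (n : ℂ) ^ (s - 1) * Complex.exp (-(2 * Real.pi * n * y)) *
        Complex.exp (2 * Real.pi * Complex.I * ((n : ℤ) - 1 : ℤ) * x) := fun x => by
      simp only [G]
      rw [mul_assoc (_ ^ _), mul_assoc (_ ^ _), ← Complex.exp_add, ← Complex.exp_add]
      congr 2
      push_cast
      linear_combination (2 * Real.pi * n * y : ℂ) * Complex.I_sq
    simp_rw [this]
    rw [integral_const_mul, integral_exp_two_pi_int]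
    by_cases hn : n = 1
    · simp [hn]
    · have : ((n : ℤ) - 1 : ℤ) ≠ 0 := fun h => hn (by
        apply PNat.coe_injective; simpa using (by omega : (n : ℕ) = 1))
      rw [if_neg this, if_neg hn, mul_zero]
  simp_rw [hcoef, tsum_ite_eq] at hsum
  have hq : ∀ x : ℝ, ∑' n, G n x =
      qSeries s (x + y * Complex.I) * Complex.exp (-(2 * Real.pi * Complex.I * x)) := fun x => by
    rw [qSeries, ← tsum_mul_right]
  calc ENNReal.ofReal (Real.exp (-(2 * Real.pi * y)))
      = ‖((Real.exp (-(2 * Real.pi * y)) : ℝ) : ℂ)‖ₑ := by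
        rw [← ofReal_norm, Complex.norm_real, Real.norm_of_nonneg (Real.exp_pos _).le]
    _ = ‖∫ x in Set.Ico (0 : ℝ) 1, ∑' n, G n x‖ₑ := by rw [← hsum]
    _ ≤ ∫⁻ x in Set.Ico (0 : ℝ) 1, ‖∑' n, G n x‖ₑ := enorm_integral_le_lintegral_enorm _
    _ = _ := by
        refine lintegral_congr fun x => ?_
        have : ‖Complex.exp (-(2 * Real.pi * Complex.I * x))‖ₑ = 1 := by
          rw [← ofReal_norm, Complex.norm_exp]; simp
        rw [hq, enorm_mul, this, mul_one]

/-! ### Integrals over horizontal strips -/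

/-- The rectangle `re z ∈ I`, `im z ∈ J` in the upper half-plane. -/
def UpperHalfPlane.rect (I J : Set ℝ) : Set ℍ := {z | z.re ∈ I ∧ z.im ∈ J}

theorem UpperHalfPlane.measurableSet_rect {I J : Set ℝ} (hI : MeasurableSet I)
    (hJ : MeasurableSet J) : MeasurableSet (rect I J) :=
  (UpperHalfPlane.continuous_re.measurable hI).inter (UpperHalfPlane.continuous_im.measurable hJ)

theorem UpperHalfPlane.coe_image_rect {I J : Set ℝ} (hJ0 : J ⊆ Set.Ioi 0) :
    UpperHalfPlane.coe '' rect I J = I ×ℂ J := by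
  ext w
  constructor
  · rintro ⟨z, hz, rfl⟩
    exact hz
  · intro hw
    exact ⟨⟨w, hJ0 hw.2⟩, hw, rfl⟩

/-- The invariant measure on a rectangle, in Cartesian coordinates. -/
theorem UpperHalfPlane.lintegral_rect {I J : Set ℝ} (hI : MeasurableSet I) (hJ : MeasurableSet J)
    (hJ0 : J ⊆ Set.Ioi 0) {g : ℂ → ENNReal} (hg : Measurable g) :
    ∫⁻ z in rect I J, g z =
      ∫⁻ y in J, (∫⁻ x in I, g (x + y * Complex.I)) * ENNReal.ofReal ((y ^ 2)⁻¹) := by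
  have hd : ∀ z : ℍ, (((1 / NNReal.mk z.im z.im_pos.le : NNReal) ^ 2 : NNReal) : ENNReal) =
      ENNReal.ofReal (((z : ℂ).im ^ 2)⁻¹) := fun z => by
    rw [ENNReal.ofReal, ENNReal.coe_inj]
    ext
    rw [Real.coe_toNNReal _ (by positivity)]
    simp
  have hmp : MeasurePreserving UpperHalfPlane.coe (volume.comap UpperHalfPlane.coe)
      (volume.restrict (.range UpperHalfPlane.coe)) :=
    ⟨measurable_coe, by rw [measurableEmbedding_coe.map_comap]⟩
  have hJI : MeasurableSet (I ×ℂ J) :=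
    (Complex.measurable_re hI).inter (Complex.measurable_im hJ)
  have hsub : I ×ℂ J ⊆ Set.range UpperHalfPlane.coe := by
    rw [← coe_image_rect hJ0]; exact Set.image_subset_range _ _
  have hpre : Complex.measurableEquivRealProd ⁻¹' (I ×ˢ J) = I ×ℂ J := rfl
  rw [volume_def]
  simp_rw [hd]
  rw [setLIntegral_withDensity_eq_setLIntegral_mul _ (by fun_prop)
    (g := fun z : ℍ => g z) (hg.comp measurable_coe) (measurableSet_rect hI hJ)]
  have h1 := hmp.setLIntegral_comp_emb measurableEmbedding_coe
    (fun w : ℂ => ENNReal.ofReal ((w.im ^ 2)⁻¹) * g w) (rect I J)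
  rw [coe_image_rect hJ0, Measure.restrict_restrict hJI, Set.inter_eq_left.2 hsub] at h1
  refine h1.trans ?_
  have h2 := Complex.volume_preserving_equiv_real_prod.setLIntegral_comp_preimage_emb
    Complex.measurableEquivRealProd.measurableEmbedding
    (fun p : ℝ × ℝ => ENNReal.ofReal ((p.2 ^ 2)⁻¹) * g (p.1 + p.2 * Complex.I)) (I ×ˢ J)
  rw [hpre] at h2
  have h3 : ∫⁻ w in I ×ℂ J, ENNReal.ofReal ((w.im ^ 2)⁻¹) * g w =
      ∫⁻ w in I ×ℂ J, (fun p : ℝ × ℝ => ENNReal.ofReal ((p.2 ^ 2)⁻¹) *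
        g (p.1 + p.2 * Complex.I)) (Complex.measurableEquivRealProd w) := by
    refine lintegral_congr fun w => ?_
    simp [Complex.measurableEquivRealProd_apply, Complex.re_add_im]
  rw [h3, h2, Measure.volume_eq_prod, ← Measure.prod_restrict, lintegral_prod_symm _ (by fun_prop)]
  refine lintegral_congr fun y => ?_
  dsimp only
  rw [lintegral_const_mul _ (by fun_prop), mul_comm]

theorem lintegral_Ico_scale {h : ℝ} (hh : 0 < h) (g : ℝ → ENNReal) :
    ∫⁻ x in Set.Ico 0 h, g (x / h) = ENNReal.ofReal h * ∫⁻ x in Set.Ico (0 : ℝ) 1, g x := by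
  have him : (fun x : ℝ => h * x) '' Set.Ico 0 1 = Set.Ico 0 h := by
    rw [Set.image_mul_left_Ico hh]; simp
  rw [← him, lintegral_image_eq_lintegral_abs_deriv_mul measurableSet_Ico
    (f := fun x => h * x) (fun x _ => ((hasDerivAt_id x).const_mul h).hasDerivWithinAt)
    (mul_right_injective₀ hh.ne').injOn, mul_one, abs_of_pos hh, lintegral_const_mul' _ _ (by simp)]
  simp [mul_div_cancel_left₀ _ hh.ne']

/-- The weighted absolute value `|F(z, s)| (im z)^{m/2}`, with values in `[0, ∞]` and as a function
of a complex variable; it is invariant under `z ↦ z + h`. -/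
noncomputable def weightedF (h : ℝ) (s : ℂ) (m : ℝ) (w : ℂ) : ENNReal :=
  ‖qSeries s (w / h)‖ₑ * ENNReal.ofReal (w.im ^ (m / 2))

@[fun_prop]
theorem measurable_weightedF (h : ℝ) (s : ℂ) (m : ℝ) : Measurable (weightedF h s m) := by
  unfold weightedF; fun_prop

theorem lintegral_weightedF {h : ℝ} (hh : 0 < h) (s : ℂ) (m : ℝ) {J : Set ℝ}
    (hJ : MeasurableSet J) (hJ0 : J ⊆ Set.Ioi 0) :
    ∫⁻ z in rect (Set.Ico 0 h) J, weightedF h s m z =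
      ∫⁻ y in J, (∫⁻ x in Set.Ico (0 : ℝ) 1, ‖qSeries s (x + (y / h : ℝ) * Complex.I)‖ₑ) *
        ENNReal.ofReal (h * y ^ (m / 2 - 2)) := by
  rw [lintegral_rect measurableSet_Ico hJ hJ0 (measurable_weightedF h s m)]
  refine setLIntegral_congr_fun hJ fun y hy => ?_
  have hy0 : 0 < y := hJ0 hy
  have h1 : ∀ x : ℝ, weightedF h s m (x + y * Complex.I) =
      (fun x : ℝ => ‖qSeries s (x + (y / h : ℝ) * Complex.I)‖ₑ * ENNReal.ofReal (y ^ (m / 2)))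
        (x / h) := fun x => by
    simp only [weightedF]
    congr 2
    · congr 1; push_cast; ring
    · simp
  rw [lintegral_congr h1, lintegral_Ico_scale hh (fun x : ℝ =>
    ‖qSeries s (x + (y / h : ℝ) * Complex.I)‖ₑ * ENNReal.ofReal (y ^ (m / 2))),
    lintegral_mul_const _ (by fun_prop), mul_comm (ENNReal.ofReal h),
    mul_assoc, mul_assoc, ← ENNReal.ofReal_mul hh.le, ← ENNReal.ofReal_mul (by positivity)]
  congr 2
  rw [Real.rpow_sub hy0]
  norm_num
  ring

/-- Upper bound for the mass below height `Y`. -/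
theorem lintegral_weightedF_low_le {h : ℝ} (hh : 0 < h) {s : ℂ} (hs : 1 < s.re) {m : ℝ}
    (hsm : s.re < m / 2) {Y : ℝ} (hY : 0 < Y) :
    ∫⁻ z in rect (Set.Ico 0 h) (Set.Ioo 0 Y), weightedF h s m z ≤
      ENNReal.ofReal (1 / 2 * (h / Real.pi) ^ s.re * (Real.exp (Real.pi / 2 * |s.im|) *
        Real.Gamma ((s.re + 1) / 2) * Real.Gamma ((s.re - 1) / 2)) *
        (Y ^ (m / 2 - s.re) / (m / 2 - s.re))) := by
  have hG1 : 0 < Real.Gamma ((s.re + 1) / 2) := Real.Gamma_pos_of_pos (by linarith)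
  have hG2 : 0 < Real.Gamma ((s.re - 1) / 2) := Real.Gamma_pos_of_pos (by linarith)
  set E := Real.exp (Real.pi / 2 * |s.im|) *
        Real.Gamma ((s.re + 1) / 2) * Real.Gamma ((s.re - 1) / 2) with hE
  have hE0 : 0 < E := by positivity
  rw [lintegral_weightedF hh s m measurableSet_Ioo Set.Ioo_subset_Ioi_self]
  calc _ ≤ ∫⁻ y in Set.Ioo 0 Y, ENNReal.ofReal
        ((1 / 2 * (h / Real.pi) ^ s.re * E) * y ^ (m / 2 - s.re - 1)) := by
        refine setLIntegral_mono' measurableSet_Ioo fun y hy => ?_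
        have hy0 : 0 < y := hy.1
        refine (mul_le_mul_left (lintegral_qSeries_le hs (div_pos hy0 hh)) _).trans_eq ?_
        rw [← hE, ← ENNReal.ofReal_mul (by positivity)]
        congr 1
        rw [Real.div_rpow hy0.le hh.le, Real.div_rpow hh.le Real.pi_pos.le,
          Real.rpow_neg Real.pi_pos.le, Real.rpow_sub hh, Real.rpow_one,
          show m / 2 - s.re - 1 = (1 - s.re) + (m / 2 - 2) by ring, Real.rpow_add hy0]
        field_simp
    _ = _ := by
        have hi : IntegrableOn (fun y : ℝ => y ^ (m / 2 - s.re - 1)) (Set.Ioo 0 Y) :=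
          (intervalIntegral.integrableOn_Ioo_rpow_iff hY).2 (by linarith)
        rw [← ofReal_integral_eq_lintegral_ofReal (hi.const_mul _)
          ((ae_restrict_iff' measurableSet_Ioo).2 (.of_forall fun y hy => by
            have : 0 < y := hy.1
            positivity)), integral_const_mul, ← integral_Ioc_eq_integral_Ioo,
          ← intervalIntegral.integral_of_le hY.le, integral_rpow (Or.inl (by linarith)),
          Real.zero_rpow (by linarith)]
        simp

/-- Lower bound for the mass above height `Y`, below the median of the gamma distribution. -/
theorem lt_lintegral_weightedF_high {h : ℝ} (hh : 0 < h) (s : ℂ) {m Y : ℝ} (hY : 0 < Y)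
    (hm : 2 * Real.pi / h * Y ≤ m / 2 - 1 - 1 / 3) :
    ENNReal.ofReal (h * (h / (2 * Real.pi)) ^ (m / 2 - 1) * (Real.Gamma (m / 2 - 1) / 2)) <
      ∫⁻ z in rect (Set.Ico 0 h) (Set.Ioi Y), weightedF h s m z := by
  have hb : 0 < 2 * Real.pi / h := by positivity
  have hbY : 0 < 2 * Real.pi / h * Y := by positivity
  have ha : 0 < m / 2 - 1 := by linarith
  set b := 2 * Real.pi / h with hbdef
  set g : ℝ → ℝ := fun t => Real.exp (-t) * t ^ (m / 2 - 1 - 1) with hg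
  have hmed := gamma_median hbY hm
  have hg1 := integral_comp_mul_left_Ioi g Y hb
  have hgi : IntegrableOn (fun y => g (b * y)) (Set.Ioi Y) := by
    rw [integrableOn_Ioi_comp_mul_left_iff _ _ hb]
    exact (Real.GammaIntegral_convergent ha).mono_set (Set.Ioi_subset_Ioi hbY.le)
  rw [lintegral_weightedF hh s m measurableSet_Ioi (Set.Ioi_subset_Ioi hY.le)]
  have hc : 0 < h * b⁻¹ ^ (m / 2 - 1) := by positivity
  calc _ < ENNReal.ofReal (h * b⁻¹ ^ (m / 2 - 1) * ∫ t in Set.Ioi (b * Y), g t) := by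
        have hpos : 0 < Real.Gamma (m / 2 - 1) := Real.Gamma_pos_of_pos ha
        rw [ENNReal.ofReal_lt_ofReal_iff (mul_pos hc (by change _ < _ at hmed; linarith)),
          hbdef, inv_div]
        rw [hbdef, inv_div] at hc
        exact mul_lt_mul_of_pos_left hmed hc
    _ = ∫⁻ y in Set.Ioi Y, ENNReal.ofReal ((h * b⁻¹ ^ (m / 2 - 2)) * g (b * y)) := by
        rw [← ofReal_integral_eq_lintegral_ofReal (hgi.const_mul _)
          ((ae_restrict_iff' measurableSet_Ioi).2 (.of_forall fun y hy => by
            have : 0 < y := hY.trans hy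
            simp only [hg]
            positivity)), integral_const_mul, hg1, smul_eq_mul]
        congr 1
        rw [show m / 2 - 1 = (m / 2 - 2) + 1 by ring, Real.rpow_add (by positivity), Real.rpow_one]
        ring
    _ ≤ _ := by
        refine setLIntegral_mono' measurableSet_Ioi fun y hy => ?_
        have hy0 : 0 < y := hY.trans hy
        refine le_trans (le_of_eq ?_) (mul_le_mul_left (le_lintegral_qSeries (div_pos hy0 hh)) _)
        rw [← ENNReal.ofReal_mul (by positivity)]
        congr 1
        simp only [hg]
        rw [Real.mul_rpow hb.le hy0.le, show m / 2 - 1 - 1 = m / 2 - 2 by ring,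
          Real.inv_rpow hb.le, show b * y = 2 * Real.pi * (y / h) by rw [hbdef]; ring]
        have : b ^ (m / 2 - 2) ≠ 0 := by positivity
        field_simp

/-! ### The stabilizer of the cusp -/

namespace Mp2

theorem proj_surjective : Function.Surjective proj := fun g =>
  ⟨ofVal g (((g 1 0 : ℂ) * ((I : ℍ) : ℂ) + (g 1 1 : ℂ)) ^ (1 / 2 : ℂ)) (by
    rw [one_div]; exact_mod_cast Complex.cpow_nat_inv_pow _ two_ne_zero), rfl⟩

theorem exists_mat_eq_of_mem_center {ζ : Mp2} (hζ : ζ ∈ Subgroup.center Mp2) :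
    ζ.mat = 1 ∨ ζ.mat = -1 := by
  have h1 : ζ.mat ∈ Subgroup.center SL(2, ℝ) := by
    rw [Subgroup.mem_center_iff] at hζ ⊢
    intro g
    obtain ⟨σ, rfl⟩ := proj_surjective g
    exact congrArg mat (hζ σ)
  rw [Matrix.SpecialLinearGroup.mem_center_iff] at h1
  obtain ⟨r, hr, hr'⟩ := h1
  rcases mul_self_eq_one_iff.1 (by simpa [sq] using hr : r * r = 1) with rfl | rfl
  · left; ext i j; rw [← hr']; simp
  · right; ext i j; rw [← hr']; fin_cases i <;> fin_cases j <;> simp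

theorem n_mul_n (x y : ℝ) : n x * n y = n (x + y) := by
  ext z
  · rename_i j
    rw [mul_mat, Matrix.SpecialLinearGroup.coe_mul]
    fin_cases z <;> fin_cases j <;> simp [n, add_comm]
  · simp [n]

theorem n_zpow (x : ℝ) (j : ℤ) : n x ^ j = n (j * x) := by
  have h0 : n 0 = 1 := by
    ext z
    · rename_i j
      fin_cases z <;> fin_cases j <;> simp [n]
    · simp [n]
  let f : Multiplicative ℝ →* Mp2 :=
    { toFun := fun y => n y.toAdd
      map_one' := h0
      map_mul' := fun a b => (n_mul_n _ _).symm }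
  have h1 := map_zpow f (Multiplicative.ofAdd x) j
  rw [← ofAdd_zsmul, zsmul_eq_mul] at h1
  exact h1.symm

theorem coe_n_smul (x : ℝ) (z : ℍ) : (((n x).mat • z : ℍ) : ℂ) = z + x := by
  rw [coe_specialLinearGroup_apply]
  simp [n]

theorem center_smul {ζ : Mp2} (hζ : ζ ∈ Subgroup.center Mp2) (z : ℍ) : ζ.mat • z = z := by
  rcases exists_mat_eq_of_mem_center hζ with h | h
  · rw [h, one_smul]
  · ext1
    rw [h, coe_specialLinearGroup_apply]
    simp

theorem mem_stabInfty {Γ : Subgroup Mp2} {σ : Mp2} :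
    σ ∈ stabInfty Γ ↔ σ ∈ Γ ∧ σ.mat 1 0 = 0 := by
  rw [stabInfty, Subgroup.mem_inf, Subgroup.mem_comap, MulAction.mem_stabilizer_iff,
    OnePoint.smul_infty_eq_self_iff]
  rfl

section

variable {Γ : Subgroup Mp2} {h : ℝ}

theorem exists_eq_center_mul_n (hwidth : Subgroup.center Mp2 ⊔ stabInfty Γ =
      Subgroup.center Mp2 ⊔ Subgroup.zpowers (n h)) {σ : Mp2} (hσ : σ ∈ stabInfty Γ) :
    ∃ ζ ∈ Subgroup.center Mp2, ∃ j : ℤ, σ = ζ * n (j * h) := by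
  have h1 : σ ∈ Subgroup.center Mp2 ⊔ Subgroup.zpowers (n h) := by
    rw [← hwidth]; exact Subgroup.mem_sup_right hσ
  obtain ⟨ζ, hζ, τ, ⟨j, rfl⟩, rfl⟩ := Subgroup.mem_sup_of_normal_left.1 h1
  exact ⟨ζ, hζ, j, by rw [← n_zpow]⟩

theorem exists_center_mul_n_mem (hwidth : Subgroup.center Mp2 ⊔ stabInfty Γ =
      Subgroup.center Mp2 ⊔ Subgroup.zpowers (n h)) (j : ℤ) :
    ∃ ζ ∈ Subgroup.center Mp2, ζ * n (j * h) ∈ stabInfty Γ := by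
  have h1 : n (j * h) ∈ Subgroup.center Mp2 ⊔ stabInfty Γ := by
    rw [hwidth, ← n_zpow]
    exact Subgroup.mem_sup_right ⟨j, rfl⟩
  obtain ⟨ζ, hζ, τ, hτ, h2⟩ := Subgroup.mem_sup_of_normal_left.1 h1
  exact ⟨ζ⁻¹, inv_mem hζ, by rw [← h2, inv_mul_cancel_left]; exact hτ⟩

theorem coe_center_mul_n_smul {ζ : Mp2} (hζ : ζ ∈ Subgroup.center Mp2) (x : ℝ) (z : ℍ) :
    (((ζ * n x).mat • z : ℍ) : ℂ) = z + x := by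
  rw [mul_mat, mul_smul, center_smul hζ, coe_n_smul]

/-! ### Discreteness -/

instance : SecondCountableTopology Mp2 := by
  have : SecondCountableTopology (Matrix (Fin 2) (Fin 2) ℝ) :=
    inferInstanceAs (SecondCountableTopology (Fin 2 → Fin 2 → ℝ))
  have : SecondCountableTopology SL(2, ℝ) :=
    (Matrix.SpecialLinearGroup.isClosedEmbedding_val (n := Fin 2)
      (R := ℝ)).isInducing.secondCountableTopology
  exact isClosedEmbedding_val.isInducing.secondCountableTopology

instance : T2Space Mp2 := isClosedEmbedding_val.isEmbedding.t2Space

theorem isCompact_bounded (R : ℝ) : IsCompact {σ : Mp2 | ∀ i j, |σ.mat i j| ≤ R} := by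
  have h1 : IsCompact {A : Matrix (Fin 2) (Fin 2) ℝ | ∀ i j, |A i j| ≤ R} := by
    have : {A : Matrix (Fin 2) (Fin 2) ℝ | ∀ i j, |A i j| ≤ R} =
        Set.univ.pi fun _ => Set.univ.pi fun _ => Set.Icc (-R) R := by
      ext A
      exact ⟨fun h i _ j _ => abs_le.1 (h i j), fun h i j => abs_le.2 (h i trivial j trivial)⟩
    rw [this]
    exact isCompact_univ_pi fun _ => isCompact_univ_pi fun _ => isCompact_Icc
  have h2 := (Matrix.SpecialLinearGroup.isClosedEmbedding_val (n := Fin 2)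
    (R := ℝ)).isCompact_preimage h1
  have h3 := isClosedEmbedding_val.isCompact_preimage
    (h2.prod (isCompact_closedBall (0 : ℂ) (R + R + 1)))
  refine h3.of_isClosed_subset ?_ fun σ hσ => ⟨hσ, ?_⟩
  · simp only [Set.ofPred_forall]
    refine isClosed_iInter fun i => isClosed_iInter fun j => isClosed_le ?_ continuous_const
    have : Continuous fun σ : Mp2 => (σ.mat : Matrix (Fin 2) (Fin 2) ℝ) :=
      continuous_subtype_val.comp continuous_mat
    exact (this.matrix_elem i j).abs
  · have h4 : ‖σ.eta I‖ ^ 2 ≤ R + R := by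
      rw [← norm_pow, σ.eta_sq]
      refine (norm_add_le _ _).trans (add_le_add ?_ ?_)
      · simpa using hσ 1 0
      · simpa using hσ 1 1
    have := norm_nonneg (σ.eta I)
    simp only [mem_closedBall_zero_iff]
    nlinarith

theorem finite_bounded (hd : DiscreteTopology Γ) (R : ℝ) :
    {σ : Mp2 | σ ∈ Γ ∧ ∀ i j, |σ.mat i j| ≤ R}.Finite := by
  have hcl : IsClosed (Γ : Set Mp2) := Subgroup.isClosed_of_discrete
  have h1 : IsCompact ((↑) ⁻¹' {σ : Mp2 | ∀ i j, |σ.mat i j| ≤ R} : Set Γ) :=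
    hcl.isClosedEmbedding_subtypeVal.isCompact_preimage (isCompact_bounded R)
  refine (h1.finite_of_discrete.image (↑)).subset fun σ hσ => ⟨⟨σ, hσ.1⟩, hσ.2, rfl⟩

theorem conj_n_apply (g : SL(2, ℝ)) (x : ℝ) :
    (g * (n x).mat * g⁻¹) 0 0 = 1 - g 0 0 * g 1 0 * x ∧
    (g * (n x).mat * g⁻¹) 0 1 = g 0 0 ^ 2 * x ∧
    (g * (n x).mat * g⁻¹) 1 0 = -(g 1 0 ^ 2 * x) ∧
    (g * (n x).mat * g⁻¹) 1 1 = 1 + g 0 0 * g 1 0 * x := by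
  have hdet : g 0 0 * g 1 1 - g 0 1 * g 1 0 = 1 := by
    rw [← Matrix.det_fin_two]; exact g.det_coe
  rw [Matrix.SpecialLinearGroup.coe_mul, Matrix.SpecialLinearGroup.coe_mul,
    Matrix.SpecialLinearGroup.coe_inv, Matrix.adjugate_fin_two]
  simp only [n, Matrix.mul_apply, Fin.sum_univ_two, Matrix.of_apply,
    Matrix.cons_val', Matrix.cons_val_zero, Matrix.cons_val_one, Matrix.cons_val_fin_one]
  refine ⟨?_, ?_, ?_, ?_⟩
  · linear_combination hdet
  · ring
  · ring
  · linear_combination hdet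

/-- A form of Shimizu's lemma. After a translation the conjugate of the parabolic generator by an
element with lower left entry `c` has bounded entries, and its own lower left entry is `-c² h`. -/
theorem exists_pos_le_abs (hd : DiscreteTopology Γ) (hh : 0 < h)
    (hwidth : Subgroup.center Mp2 ⊔ stabInfty Γ =
      Subgroup.center Mp2 ⊔ Subgroup.zpowers (n h)) :
    ∃ δ > 0, ∀ γ ∈ Γ, γ ∉ stabInfty Γ → δ ≤ |γ.mat 1 0| := by
  obtain ⟨ζ, hζ, hp⟩ := exists_center_mul_n_mem hwidth 1
  rw [Int.cast_one, one_mul] at hp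
  set R : ℝ := 1 + h + h ^ 2 + h ^ 3 with hR
  have hfin := (finite_bounded hd R).image fun σ => |σ.mat 1 0|
  -- only finitely many elements of `Γ` have entries bounded by `R`
  obtain ⟨ε, hε, hεF⟩ : ∃ ε > 0, ∀ σ ∈ Γ, (∀ i j, |σ.mat i j| ≤ R) → σ.mat 1 0 ≠ 0 →
      ε ≤ |σ.mat 1 0| := by
    have hcl : IsClosed (((fun σ : Mp2 => |σ.mat 1 0|) ''
        {σ : Mp2 | σ ∈ Γ ∧ ∀ i j, |σ.mat i j| ≤ R}) \ {0}) :=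
      (hfin.subset Set.sdiff_subset).isClosed
    obtain ⟨ε, hε, hball⟩ := Metric.isOpen_iff.1 hcl.isOpen_compl 0 (by simp)
    refine ⟨ε, hε, fun σ hσ hσR h0 => ?_⟩
    by_contra hlt
    have hmem : |σ.mat 1 0| ∈ Metric.ball (0 : ℝ) ε := by simpa using hlt
    exact hball hmem ⟨⟨σ, ⟨hσ, hσR⟩, rfl⟩, by simpa using h0⟩
  refine ⟨min 1 (ε / h), by positivity, fun γ hγ hγ' => ?_⟩
  by_contra hlt
  rw [not_le, lt_min_iff, lt_div_iff₀ hh] at hlt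
  have hc : γ.mat 1 0 ≠ 0 := fun h0 => hγ' (mem_stabInfty.2 ⟨hγ, h0⟩)
  -- a translation on the left makes the upper left entry small
  obtain ⟨j, hj⟩ : ∃ j : ℤ, |γ.mat 0 0 + j * h * γ.mat 1 0| ≤ h * |γ.mat 1 0| := by
    refine ⟨-⌊γ.mat 0 0 / (h * γ.mat 1 0)⌋, ?_⟩
    have hne : h * γ.mat 1 0 ≠ 0 := mul_ne_zero hh.ne' hc
    have : γ.mat 0 0 + ((-⌊γ.mat 0 0 / (h * γ.mat 1 0)⌋ : ℤ) : ℝ) * h * γ.mat 1 0 =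
        Int.fract (γ.mat 0 0 / (h * γ.mat 1 0)) * (h * γ.mat 1 0) := by
      rw [Int.fract, sub_mul, div_mul_cancel₀ _ hne]; push_cast; ring
    rw [this, abs_mul, abs_mul, abs_of_pos hh, abs_of_nonneg (Int.fract_nonneg _)]
    exact mul_le_of_le_one_left (by positivity) (Int.fract_lt_one _).le
  obtain ⟨ξ, hξ, hξΓ⟩ := exists_center_mul_n_mem hwidth j
  set τ : Mp2 := (ξ * n (j * h) * γ) * (ζ * n h) * (ξ * n (j * h) * γ)⁻¹ with hτ
  have hτΓ : τ ∈ Γ := by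
    have h1 := Γ.mul_mem (mem_stabInfty.1 hξΓ).1 hγ
    exact Γ.mul_mem (Γ.mul_mem h1 (mem_stabInfty.1 hp).1) (Γ.inv_mem h1)
  set c := γ.mat 1 0
  set a := γ.mat 0 0 + j * h * c with ha
  have hmat : ∃ e : ℝ, (e = 1 ∨ e = -1) ∧ τ.mat 0 0 = e * (1 - a * c * h) ∧
      τ.mat 0 1 = e * (a ^ 2 * h) ∧ τ.mat 1 0 = e * (-(c ^ 2 * h)) ∧
      τ.mat 1 1 = e * (1 + a * c * h) := by
    have h1 : τ.mat = ζ.mat * (((n (j * h)).mat * γ.mat) * (n h).mat *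
        ((n (j * h)).mat * γ.mat)⁻¹) := by
      rcases exists_mat_eq_of_mem_center hζ with h1 | h1 <;>
      rcases exists_mat_eq_of_mem_center hξ with h2 | h2 <;>
      simp [hτ, h1, h2, mul_assoc]
    have e0 : ((n (j * h)).mat * γ.mat) 0 0 = a := by
      rw [Matrix.SpecialLinearGroup.coe_mul]; simp [n, Matrix.mul_apply, ha, c]
    have e1 : ((n (j * h)).mat * γ.mat) 1 0 = c := by
      rw [Matrix.SpecialLinearGroup.coe_mul]; simp [n, Matrix.mul_apply, c]
    obtain ⟨k00, k01, k10, k11⟩ := conj_n_apply ((n (j * h)).mat * γ.mat) h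
    rw [e0] at k00 k01 k11
    rw [e1] at k00 k10 k11
    rcases exists_mat_eq_of_mem_center hζ with h2 | h2
    · exact ⟨1, .inl rfl, by
        rw [h1, h2, one_mul]
        simp only [k00, k01, k10, k11, one_mul, and_self]⟩
    · exact ⟨-1, .inr rfl, by
        rw [h1, h2, neg_one_mul, Matrix.SpecialLinearGroup.coe_neg]
        simp only [Matrix.neg_apply, k00, k01, k10, k11, neg_one_mul, and_self]⟩
  obtain ⟨e, he, h00, h01, h10, h11⟩ := hmat
  have hea : |e| = 1 := by rcases he with rfl | rfl <;> simp
  have hcle : |c| ≤ 1 := hlt.1.le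
  have hac : |a| ≤ h := hj.trans (mul_le_of_le_one_right hh.le hcle)
  have hach : |a * c * h| ≤ h ^ 2 := by
    rw [abs_mul, abs_mul, abs_of_pos hh, sq]
    gcongr
    exact (mul_le_of_le_one_right (abs_nonneg _) hcle).trans hac
  have hc2 : |c ^ 2 * h| ≤ |c| * h := by
    rw [abs_mul, abs_pow, abs_of_pos hh]
    gcongr
    rw [sq]; exact mul_le_of_le_one_left (abs_nonneg _) hcle
  have hh2 : 0 < h ^ 2 := by positivity
  have hh3 : 0 < h ^ 3 := by positivity
  have hbd : ∀ i j, |τ.mat i j| ≤ R := by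
    have b00 : |τ.mat 0 0| ≤ R := by
      rw [h00, abs_mul, hea, one_mul]
      rw [abs_le] at hach ⊢; constructor <;> linarith
    have b11 : |τ.mat 1 1| ≤ R := by
      rw [h11, abs_mul, hea, one_mul]
      rw [abs_le] at hach ⊢; constructor <;> linarith
    have b10 : |τ.mat 1 0| ≤ R := by
      rw [h10, abs_mul, hea, one_mul, abs_neg]
      have : |c| * h ≤ h := mul_le_of_le_one_left hh.le hcle
      linarith
    have b01 : |τ.mat 0 1| ≤ R := by
      rw [h01, abs_mul, hea, one_mul, abs_mul, abs_pow, abs_of_pos hh]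
      have : |a| ^ 2 * h ≤ h ^ 2 * h := by gcongr
      nlinarith
    intro i j
    fin_cases i <;> fin_cases j <;> assumption
  have := hεF τ hτΓ hbd (by
    rw [h10]; rcases he with rfl | rfl <;> simp [hc, hh.ne'])
  rw [h10, abs_mul, hea, one_mul, abs_neg] at this
  linarith [hlt.2]

theorem im_smul_mul_norm_sq (g : SL(2, ℝ)) (z : ℍ) :
    (g • z).im * ‖(g 1 0 : ℂ) * (z : ℂ) + (g 1 1 : ℂ)‖ ^ 2 = z.im := by
  have h0 : ‖(g 1 0 : ℂ) * (z : ℂ) + (g 1 1 : ℂ)‖ ≠ 0 := norm_ne_zero_iff.2 (denom_ne g z)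
  have h1 := UpperHalfPlane.im_smul_eq_div_normSq (Matrix.SpecialLinearGroup.mapGL ℝ g) z
  change (g • z).im = _ / Complex.normSq ((g 1 0 : ℂ) * (z : ℂ) + (g 1 1 : ℂ)) at h1
  rw [h1, Complex.normSq_eq_norm_sq, div_mul_cancel₀ _ (pow_ne_zero 2 h0)]
  simp

theorem im_smul_lt {g : SL(2, ℝ)} {N : ℝ} (hN : 0 < N) (hg : N ≤ |g 1 0|) {z : ℍ}
    (hz : 1 / N < z.im) : (g • z).im < 1 / N := by
  have h1 := im_smul_mul_norm_sq g z
  have h2 : |g 1 0| * z.im ≤ ‖(g 1 0 : ℂ) * (z : ℂ) + (g 1 1 : ℂ)‖ := by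
    have := Complex.abs_im_le_norm ((g 1 0 : ℂ) * (z : ℂ) + (g 1 1 : ℂ))
    simpa [abs_mul, abs_of_pos z.im_pos] using this
  have hpos := (g • z).im_pos
  have hy := z.im_pos
  rw [div_lt_iff₀ hN] at hz
  have h3 : N * z.im ≤ |g 1 0| * z.im := by gcongr
  have h4 : (g • z).im * (N * z.im) ^ 2 ≤ z.im := by
    calc _ ≤ (g • z).im * ‖(g 1 0 : ℂ) * (z : ℂ) + (g 1 1 : ℂ)‖ ^ 2 := by
          gcongr; exact h3.trans h2
      _ = _ := h1
  have h5 : (g • z).im * N * (N * z.im) ≤ 1 := by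
    refine le_of_mul_le_mul_right ?_ hy
    linarith
  rw [lt_div_iff₀ hN]
  have : 0 < (g • z).im * N := by positivity
  nlinarith

end

/-! ### Unfolding -/

theorem weightedF_add {h : ℝ} (hh : 0 < h) (s : ℂ) (m : ℝ) (w : ℂ) (j : ℤ) :
    weightedF h s m (w + (j * h : ℝ)) = weightedF h s m w := by
  have : (w + (j * h : ℝ)) / (h : ℂ) = w / h + j := by
    have : (h : ℂ) ≠ 0 := by exact_mod_cast hh.ne'
    push_cast; field_simp
  rw [weightedF, weightedF, this, qSeries_add_int]
  simp

theorem norm_eta_sq (σ : Mp2) (z : ℍ) :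
    (σ.mat • z).im * (‖σ.eta z‖ ^ 2) ^ 2 = z.im := by
  rw [← norm_pow, σ.eta_sq, im_smul_mul_norm_sq]

/-- Weighted by `(im z)^{m/2}`, the norm of a term of the Poincaré series only depends on the
point `γ z`. -/
theorem enorm_poincareTerm {k : ℕ} {m : ℝ} (hm : m = k + 1 / 2) {Γ : Subgroup Mp2} {χ : Γ →* ℂˣ}
    (hχ : IsOfFinOrder χ) (h : ℝ) (s : ℂ) (γ : Γ) (z : ℍ) :
    ‖poincareTerm k χ (F h s) γ z‖ₑ * ENNReal.ofReal (z.im ^ (m / 2)) =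
      weightedF h s m ((γ : Mp2).mat • z : ℍ) := by
  have hχ1 : ‖(χ γ : ℂ)‖ₑ = 1 := by
    have h1 : IsOfFinOrder (χ γ : ℂ) :=
      ((Units.coeHom ℂ).comp (MonoidHom.eval γ)).isOfFinOrder hχ
    rw [← ofReal_norm, h1.norm_eq_one, ENNReal.ofReal_one]
  have hη := norm_pos_iff.2 ((γ : Mp2).eta_ne z)
  have h2 : ‖(γ : Mp2).eta z ^ (-(2 * k + 1) : ℤ)‖ₑ * ENNReal.ofReal (z.im ^ (m / 2)) =
      ENNReal.ofReal (((γ : Mp2).mat • z).im ^ (m / 2)) := by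
    rw [← ofReal_norm, ← ENNReal.ofReal_mul (norm_nonneg _), norm_zpow,
      ← norm_eta_sq (γ : Mp2) z, Real.mul_rpow ((γ : Mp2).mat • z).im_pos.le (by positivity),
      ← pow_mul, ← Real.rpow_natCast, ← Real.rpow_mul hη.le, ← Real.rpow_intCast, mul_left_comm,
      ← Real.rpow_add hη, hm]
    congr 1
    convert mul_one _
    rw [show (((-(2 * k + 1) : ℤ) : ℝ) + ((2 * 2 : ℕ) : ℝ) * (((k : ℝ) + 1 / 2) / 2)) = 0 by
      push_cast; ring, Real.rpow_zero]
  rw [poincareTerm, slash, enorm_mul, enorm_mul, RCLike.enorm_conj, hχ1, one_mul, mul_assoc, h2]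
  rfl

/-- A vanishing series has no term exceeding the sum of the other ones. In the convention that
divergent series have sum zero this includes the non-summable case. -/
theorem enorm_le_tsum_ne {ι : Type*} {f : ι → ℂ} (hf : ∑' i, f i = 0) (i₀ : ι) :
    ‖f i₀‖ₑ ≤ ∑' i : {i // i ≠ i₀}, ‖f i‖ₑ := by
  classical
  by_cases htop : ∑' i : {i // i ≠ i₀}, ‖f i‖ₑ = ⊤
  · rw [htop]; exact le_top
  · have hs : Summable fun i : ({i₀}ᶜ : Set ι) => f i :=
      Summable.of_nnnorm (ENNReal.tsum_coe_ne_top_iff_summable.1 htop)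
    have hs' : Summable f := (Set.finite_singleton i₀).summable_compl_iff.1 hs
    have h1 := hs'.tsum_subtype_add_tsum_subtype_compl {i₀}
    rw [hf, tsum_singleton i₀ f] at h1
    rw [eq_neg_of_add_eq_zero_left h1, enorm_neg]
    exact enorm_tsum_le_tsum_enorm

section

variable {Γ : Subgroup Mp2} {h : ℝ}

/-- The cosets `Γ_∞ \ Γ`. -/
abbrev CuspCosets (Γ : Subgroup Mp2) : Type :=
  Quotient (QuotientGroup.rightRel ((stabInfty Γ).subgroupOf Γ))

theorem mk_eq_mk_iff {γ γ' : Γ} :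
    (Quotient.mk _ γ : CuspCosets Γ) = Quotient.mk _ γ' ↔ ((γ' * γ⁻¹ : Γ) : Mp2) ∈ stabInfty Γ := by
  rw [Quotient.eq, QuotientGroup.rightRel_apply, Subgroup.mem_subgroupOf]

theorem setLIntegral_smul (g : SL(2, ℝ)) (C : Set ℍ) (f : ℍ → ENNReal) :
    ∫⁻ z in C, f (g • z) = ∫⁻ w in (fun z => g • z) '' C, f w :=
  (measurePreserving_smul (Matrix.SpecialLinearGroup.mapGL ℝ g)
    (volume : Measure ℍ)).setLIntegral_comp_emb
    (measurableEmbedding_const_smul (Matrix.SpecialLinearGroup.mapGL ℝ g)) f C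

theorem eq_mk_one_iff (q : CuspCosets Γ) :
    q = Quotient.mk _ 1 ↔ (q.out : Mp2) ∈ stabInfty Γ := by
  conv_lhs => rw [← Quotient.out_eq q, eq_comm, mk_eq_mk_iff]
  simp

/-- An element of `Γ` relating two points of the half-strip above height `1 / N` is central, so the
points coincide. -/
theorem eq_of_smul_mem_rect (hh : 0 < h)
    (hwidth : Subgroup.center Mp2 ⊔ stabInfty Γ = Subgroup.center Mp2 ⊔ Subgroup.zpowers (n h))
    {N : ℝ} (hN : 0 < N) (hle : ∀ γ ∈ Γ, γ ∉ stabInfty Γ → N ≤ |γ.mat 1 0|)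
    {σ : Mp2} (hσ : σ ∈ Γ) {z : ℍ} (hz : z ∈ rect (Set.Ico 0 h) (Set.Ioi (1 / N)))
    (hz' : σ.mat • z ∈ rect (Set.Ico 0 h) (Set.Ioi (1 / N))) :
    σ ∈ Subgroup.center Mp2 ∧ σ ∈ stabInfty Γ := by
  have hst : σ ∈ stabInfty Γ := by
    by_contra hns
    exact (im_smul_lt hN (hle σ hσ hns) hz.2).not_gt hz'.2
  refine ⟨?_, hst⟩
  obtain ⟨ζ, hζ, j, rfl⟩ := exists_eq_center_mul_n hwidth hst
  have h1 := congrArg Complex.re (coe_center_mul_n_smul hζ (j * h) z)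
  have h2 := hz.1
  have h3 := hz'.1
  simp only [Complex.add_re, Complex.ofReal_re, coe_re] at h1
  rw [Set.mem_Ico] at h2 h3
  rw [h1] at h3
  have hj : j = 0 := by
    have h4 : (j : ℝ) < 1 := by
      refine lt_of_mul_lt_mul_right ?_ hh.le
      linarith
    have h5 : (-1 : ℝ) < j := by
      refine lt_of_mul_lt_mul_right ?_ hh.le
      linarith
    have h4' : j < 1 := by exact_mod_cast h4
    have h5' : -1 < j := by exact_mod_cast h5
    omega
  have hn : n (((0 : ℤ) : ℝ) * h) = 1 := by rw [← n_zpow, zpow_zero]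
  rw [hj, hn, mul_one]
  exact hζ

/-- The unfolding inequality: modulo translation by `h`, the translates of the strip above height
`1 / N` under the nontrivial cosets are disjoint and lie below height `1 / N`. -/
theorem lintegral_tsum_le (hd : DiscreteTopology Γ) (hh : 0 < h)
    (hwidth : Subgroup.center Mp2 ⊔ stabInfty Γ = Subgroup.center Mp2 ⊔ Subgroup.zpowers (n h))
    {N : ℝ} (hN : 0 < N) (hle : ∀ γ ∈ Γ, γ ∉ stabInfty Γ → N ≤ |γ.mat 1 0|)
    {φ : ℂ → ENNReal} (hφ : Measurable φ) (hper : ∀ (w : ℂ) (j : ℤ), φ (w + (j * h : ℝ)) = φ w) :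
    ∫⁻ z in rect (Set.Ico 0 h) (Set.Ioi (1 / N)),
        ∑' q : {q : CuspCosets Γ // q ≠ Quotient.mk _ 1}, φ ((q.1.out : Mp2).mat • z : ℍ) ≤
      ∫⁻ z in rect (Set.Ico 0 h) (Set.Ioo 0 (1 / N)), φ z := by
  have : Countable Γ := countable_of_Lindelof_of_discrete
  have : Countable (CuspCosets Γ) := Quotient.countable
  set C := rect (Set.Ico 0 h) (Set.Ioi (1 / N)) with hC
  set D := rect (Set.Ico 0 h) (Set.Ioo 0 (1 / N)) with hD
  have hCm : MeasurableSet C := measurableSet_rect measurableSet_Ico measurableSet_Ioi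
  have hDm : MeasurableSet D := measurableSet_rect measurableSet_Ico measurableSet_Ioo
  choose ζ hζ hζΓ using fun j : ℤ => exists_center_mul_n_mem hwidth j
  -- `T (q, j)` represents `q` and moves points by the further translation `j h`
  let T : {q : CuspCosets Γ // q ≠ Quotient.mk _ 1} × ℤ → Mp2 := fun p =>
    ζ p.2 * n (p.2 * h) * p.1.1.out
  have hTΓ : ∀ p, T p ∈ Γ := fun p =>
    Γ.mul_mem (mem_stabInfty.1 (hζΓ p.2)).1 p.1.1.out.2
  have hTcoe : ∀ p z, (((T p).mat • z : ℍ) : ℂ) =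
      ((p.1.1.out : Mp2).mat • z : ℍ) + ((p.2 * h : ℝ) : ℂ) := fun p z => by
    rw [← coe_center_mul_n_smul (hζ p.2), ← mul_smul]; rfl
  have hns : ∀ q : {q : CuspCosets Γ // q ≠ Quotient.mk _ 1}, (q.1.out : Mp2) ∉ stabInfty Γ :=
    fun q hmem => q.2 ((eq_mk_one_iff q.1).2 hmem)
  have hmeas : ∀ g : SL(2, ℝ), Measurable fun z : ℍ => g • z := fun g =>
    (measurableEmbedding_const_smul (Matrix.SpecialLinearGroup.mapGL ℝ g)).measurable
  have hind : Measurable (D.indicator fun z : ℍ => φ z) :=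
    (hφ.comp measurable_coe).indicator hDm
  -- each point of the orbit has exactly one translate in the strip `0 ≤ re < h`
  have hpt : ∀ q : {q : CuspCosets Γ // q ≠ Quotient.mk _ 1}, ∀ z ∈ C,
      φ ((q.1.out : Mp2).mat • z : ℍ) ≤
      ∑' j : ℤ, D.indicator (fun z : ℍ => φ z) ((T (q, j)).mat • z) := fun q z hz => by
    set w : ℍ := (q.1.out : Mp2).mat • z with hw
    refine le_trans ?_ (ENNReal.le_tsum (-⌊w.re / h⌋))
    rw [Set.indicator_of_mem, hTcoe, hper]
    have hre := congrArg Complex.re (hTcoe (q, -⌊w.re / h⌋) z)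
    have him := congrArg Complex.im (hTcoe (q, -⌊w.re / h⌋) z)
    simp only [Complex.add_re, Complex.add_im, Complex.ofReal_re, Complex.ofReal_im, coe_re,
      coe_im, add_zero, ← hw] at hre him
    have hfr : w.re + ((-⌊w.re / h⌋ : ℤ) : ℝ) * h = Int.fract (w.re / h) * h := by
      rw [Int.fract, sub_mul, div_mul_cancel₀ _ hh.ne']; push_cast; ring
    refine ⟨?_, ?_⟩
    · rw [hre, hfr]
      exact ⟨mul_nonneg (Int.fract_nonneg _) hh.le,
        mul_lt_of_lt_one_left hh (Int.fract_lt_one _)⟩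
    · rw [him]
      exact ⟨w.im_pos, im_smul_lt hN (hle _ q.1.out.2 (hns q)) hz.2⟩
  calc _ ≤ ∫⁻ z in C, ∑' q : {q : CuspCosets Γ // q ≠ Quotient.mk _ 1}, ∑' j : ℤ,
        D.indicator (fun z : ℍ => φ z) ((T (q, j)).mat • z) :=
        setLIntegral_mono' hCm fun z hz => ENNReal.tsum_le_tsum fun q => hpt q z hz
    _ = ∫⁻ z in C, ∑' p, D.indicator (fun z : ℍ => φ z) ((T p).mat • z) := by
        refine lintegral_congr fun z => ?_
        rw [ENNReal.tsum_prod']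
    _ = ∑' p, ∫⁻ w in (fun z => (T p).mat • z) '' C ∩ D, φ w := by
        rw [lintegral_tsum fun p => by exact (hind.comp (hmeas (T p).mat)).aemeasurable]
        refine tsum_congr fun p => ?_
        rw [setLIntegral_smul (T p).mat C (D.indicator fun z : ℍ => φ z),
          setLIntegral_indicator hDm, Set.inter_comm]
    _ = ∫⁻ w in ⋃ p, (fun z => (T p).mat • z) '' C ∩ D, φ w := by
        rw [lintegral_iUnion]
        · exact fun p => ((measurableEmbedding_const_smul
            (Matrix.SpecialLinearGroup.mapGL ℝ (T p).mat)).measurableSet_image.2 hCm).inter hDm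
        · rintro ⟨q, j⟩ ⟨q', j'⟩ hne
          refine Set.disjoint_left.2 ?_
          rintro w ⟨⟨z, hz, rfl⟩, -⟩ ⟨⟨z', hz', hzz⟩, -⟩
          refine hne ?_
          have hσz : ((T (q, j))⁻¹ * T (q', j')).mat • z' = z := by
            rw [mul_mat, mul_smul, inv_mat, inv_smul_eq_iff]; exact hzz
          obtain ⟨hσc, hσs⟩ := eq_of_smul_mem_rect hh hwidth hN hle
            (Γ.mul_mem (Γ.inv_mem (hTΓ (q, j))) (hTΓ (q', j'))) hz' (hσz ▸ hz)
          set σ := (T (q, j))⁻¹ * T (q', j') with hσ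
          have hTT : T (q', j') = T (q, j) * σ := by rw [hσ, mul_inv_cancel_left]
          have hcomm : T (q', j') = σ * T (q, j) := by
            rw [hTT]; exact (Subgroup.mem_center_iff.1 hσc _)
          have hqq : q = q' := by
            apply Subtype.ext
            rw [← Quotient.out_eq q.1, ← Quotient.out_eq q'.1, mk_eq_mk_iff]
            have : ((q'.1.out * (q.1.out)⁻¹ : Γ) : Mp2) =
                (ζ j' * n (j' * h))⁻¹ * σ * (ζ j * n (j * h)) := by
              have h1 : (q'.1.out : Mp2) = (ζ j' * n (j' * h))⁻¹ * T (q', j') := by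
                simp only [T]; group
              rw [Subgroup.coe_mul, Subgroup.coe_inv, h1, hcomm]
              simp only [T]; group
            rw [this]
            exact mul_mem (mul_mem (inv_mem (hζΓ j')) hσs) (hζΓ j)
          subst hqq
          have h5 : (((T (q, j')).mat • z : ℍ) : ℂ) = ((T (q, j)).mat • z : ℍ) := by
            rw [hTT, mul_mat, mul_smul, center_smul hσc]
          rw [hTcoe, hTcoe] at h5
          have h6 : ((j' * h : ℝ) : ℂ) = ((j * h : ℝ) : ℂ) := add_left_cancel h5
          have h7 : (j' : ℝ) = j := mul_right_cancel₀ hh.ne' (by exact_mod_cast h6)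
          rw [show j' = j by exact_mod_cast h7]
    _ ≤ _ := lintegral_mono_set (Set.iUnion_subset fun p => Set.inter_subset_right)

/-- If the Poincaré series vanishes at `z`, the term of the trivial coset is at most the sum of
the others. -/
theorem weightedF_le_tsum (hh : 0 < h)
    (hwidth : Subgroup.center Mp2 ⊔ stabInfty Γ = Subgroup.center Mp2 ⊔ Subgroup.zpowers (n h))
    {k : ℕ} {m : ℝ} (hm : m = k + 1 / 2) {χ : Γ →* ℂˣ} (hχ : IsOfFinOrder χ) {s : ℂ} {z : ℍ}
    (hΨ : Psi k χ h s z = 0) :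
    weightedF h s m z ≤ ∑' q : {q : CuspCosets Γ // q ≠ Quotient.mk _ 1},
      weightedF h s m ((q.1.out : Mp2).mat • z : ℍ) := by
  have h1 := mul_le_mul_left (enorm_le_tsum_ne hΨ (Quotient.mk _ 1))
    (ENNReal.ofReal (z.im ^ (m / 2)))
  rw [← ENNReal.tsum_mul_right, enorm_poincareTerm hm hχ] at h1
  simp_rw [enorm_poincareTerm hm hχ] at h1
  refine le_trans (le_of_eq ?_) h1
  have hst := (eq_mk_one_iff (Γ := Γ) (Quotient.mk _ 1)).1 rfl
  obtain ⟨ζ, hζ, j, hj⟩ := exists_eq_center_mul_n hwidth hst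
  rw [hj, coe_center_mul_n_smul hζ, weightedF_add hh]

end

end Mp2

theorem mainTheorem4 (k : ℕ) (m : ℝ) (hk : 2 ≤ k) (hm : m = k + 1 / 2)
    (Γ : Subgroup Mp2) (hdiscrete : DiscreteTopology Γ) (hcovol : Mp2.HasFiniteCovolume Γ)
    (hcusp : IsCusp OnePoint.infty (Mp2.image Γ))
    (χ : Γ →* ℂˣ) (hχ : IsOfFinOrder χ)
    (hχ_infty : ∀ γ : Γ, (γ : Mp2) ∈ Mp2.stabInfty Γ →
      ∀ z : ℍ, (γ : Mp2).eta z ^ (-(2 * k + 1) : ℤ) = (χ γ : ℂ))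
    (h : ℝ) (hh : 0 < h)
    (hwidth : Subgroup.center Mp2 ⊔ Mp2.stabInfty Γ =
      Subgroup.center Mp2 ⊔ Subgroup.zpowers (Mp2.n h))
    (N : ℝ) (hN : N = Mp2.level Γ)
    (hm_large : 4 * Real.pi / (N * h) + 8 / 3 ≤ m)
    (s : ℂ) (hs_left : 1 < s.re) (hs_right : s.re < m / 2)
    (hineq : Real.exp (Real.pi / 2 * |s.im|) * Real.Gamma ((s.re + 1) / 2) *
        Real.Gamma ((s.re - 1) / 2) * (2 ^ (m / 2 - 1) / Real.Gamma (m / 2 - 1)) *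
        ((Real.pi / (N * h)) ^ (m / 2 - s.re) / (m / 2 - s.re)) ≤ Real.pi) :
    ∃ z : ℍ, Mp2.Psi k χ h s z ≠ 0 := by
  by_contra! hΨ
  have hπ := Real.pi_pos
  by_cases hne : ∃ γ ∈ Γ, γ ∉ Mp2.stabInfty Γ
  · obtain ⟨δ, hδ, hδle⟩ := Mp2.exists_pos_le_abs hdiscrete hh hwidth
    have hbdd : BddBelow {x : ℝ | ∃ γ ∈ Γ, γ ∉ Mp2.stabInfty Γ ∧ x = |γ.mat 1 0|} :=
      ⟨0, by rintro x ⟨γ, -, -, rfl⟩; positivity⟩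
    have hN0 : 0 < N := by
      obtain ⟨γ, hγ, hγ'⟩ := hne
      refine hδ.trans_le (hN ▸ le_csInf ⟨_, γ, hγ, hγ', rfl⟩ ?_)
      rintro x ⟨γ, hγ, hγ', rfl⟩
      exact hδle γ hγ hγ'
    have hle : ∀ γ ∈ Γ, γ ∉ Mp2.stabInfty Γ → N ≤ |γ.mat 1 0| := fun γ hγ hγ' =>
      hN ▸ csInf_le hbdd ⟨γ, hγ, hγ', rfl⟩
    have hY : 0 < 1 / N := by positivity
    have hmed : 2 * Real.pi / h * (1 / N) ≤ m / 2 - 1 - 1 / 3 := by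
      have : 4 * Real.pi / (N * h) = 2 * (2 * Real.pi / h * (1 / N)) := by field_simp; ring
      linarith
    have hG : 0 < Real.Gamma (m / 2 - 1) := by
      refine Real.Gamma_pos_of_pos ?_
      have : 0 < 2 * Real.pi / h * (1 / N) := by positivity
      linarith
    have hunfold := (lintegral_mono fun z => Mp2.weightedF_le_tsum hh hwidth hm hχ (hΨ z)).trans
      (Mp2.lintegral_tsum_le hdiscrete hh hwidth hN0 hle (measurable_weightedF h s m)
        (Mp2.weightedF_add hh s m))
    refine (lt_lintegral_weightedF_high hh s hY hmed).not_ge (hunfold.trans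
      ((lintegral_weightedF_low_le hh hs_left hs_right hY).trans (ENNReal.ofReal_le_ofReal ?_)))
    set E := Real.exp (Real.pi / 2 * |s.im|) * Real.Gamma ((s.re + 1) / 2) *
        Real.Gamma ((s.re - 1) / 2)
    have hd : 0 < m / 2 - s.re := by linarith
    have e1 : (h / (2 * Real.pi)) ^ (m / 2 - 1) =
        (h / Real.pi) ^ (m / 2 - 1) / 2 ^ (m / 2 - 1) := by
      rw [← Real.div_rpow (by positivity) (by positivity)]
      congr 1; field_simp
    have e2 : (Real.pi / (N * h)) ^ (m / 2 - s.re) =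
        (1 / N) ^ (m / 2 - s.re) / (h / Real.pi) ^ (m / 2 - s.re) := by
      rw [← Real.div_rpow (by positivity) (by positivity)]
      congr 1; field_simp
    have e3 : (h / Real.pi) ^ s.re * (h / Real.pi) ^ (m / 2 - s.re) =
        (h / Real.pi) * (h / Real.pi) ^ (m / 2 - 1) := by
      rw [← Real.rpow_add (by positivity), ← Real.rpow_one_add' (by positivity) (by linarith)]
      congr 1; ring
    -- the hypothesis `hineq`, rescaled
    have key : 1 / 2 * (h / Real.pi) ^ s.re * E * ((1 / N) ^ (m / 2 - s.re) / (m / 2 - s.re)) =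
        (h * (h / (2 * Real.pi)) ^ (m / 2 - 1) * (Real.Gamma (m / 2 - 1) / 2) / Real.pi) *
        (E * (2 ^ (m / 2 - 1) / Real.Gamma (m / 2 - 1)) *
        ((Real.pi / (N * h)) ^ (m / 2 - s.re) / (m / 2 - s.re))) := by
      have h2 : (0 : ℝ) < 2 ^ (m / 2 - 1) := by positivity
      have h3 : 0 < (h / Real.pi) ^ (m / 2 - s.re) := by positivity
      have h4 : (h / Real.pi) ^ s.re =
          (h / Real.pi) * (h / Real.pi) ^ (m / 2 - 1) / (h / Real.pi) ^ (m / 2 - s.re) := by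
        rw [eq_div_iff h3.ne', e3]
      rw [e1, e2, h4]
      generalize (h / Real.pi) ^ (m / 2 - s.re) = A at *
      generalize (h / Real.pi) ^ (m / 2 - 1) = B at *
      generalize (2 : ℝ) ^ (m / 2 - 1) = D at *
      generalize m / 2 - s.re = d at *
      generalize Real.Gamma (m / 2 - 1) = G at *
      field_simp
    rw [key]
    refine (mul_le_mul_of_nonneg_left hineq (by positivity)).trans_eq ?_
    field_simp
  · push Not at hne
    -- the set defining the level is empty, so `N = 0` and the hypothesis on `m` reads `8 / 3 ≤ m`
    have hN0 : N = 0 := by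
      rw [hN, Mp2.level, ← Real.sInf_empty]
      congr 1
      ext x
      simp only [Set.mem_empty_iff_false, iff_false]
      rintro ⟨γ, hγ, hγ', -⟩
      exact hγ' (hne γ hγ)
    rw [hN0, zero_mul, div_zero, zero_add] at hm_large
    have hk3 : 3 ≤ k := by
      by_contra hlt
      have : (k : ℝ) ≤ 2 := by exact_mod_cast (by omega : k ≤ 2)
      linarith
    have hk3' : (3 : ℝ) ≤ k := by exact_mod_cast hk3
    have hpos : 0 < m / 2 - 1 - 1 / 3 := by linarith
    have : IsEmpty {q : Mp2.CuspCosets Γ // q ≠ Quotient.mk _ 1} :=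
      ⟨fun q => q.2 ((Mp2.eq_mk_one_iff q.1).2 (hne _ q.1.out.2))⟩
    have hzero : ∀ z : ℍ, weightedF h s m z = 0 := fun z => by
      simpa using Mp2.weightedF_le_tsum hh hwidth hm hχ (hΨ z)
    have := lt_lintegral_weightedF_high hh s (m := m)
      (Y := (m / 2 - 1 - 1 / 3) / (2 * Real.pi / h)) (by positivity)
      (mul_div_cancel₀ _ (by positivity)).le
    simp [hzero] at this
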